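/- Let $\mathbb{F}_q$ be a finite field and $k\ge 1$ an integer. For $n \ge 0$ let $\mathcal{M}_n$ be the set of monic polynomials of degree $n$ in $\mathbb{F}_q[T]$, and $\mathcal M=\bigcup_n\mathcal M_n$. For $f\in\mathcal M$ let $d_k(f)$ be the number of $k$-tuples $(a_1,\dots,a_k)\in\mathcal M^k$ with $a_1\cdots a_k=f$. For a partition $\lambda=(\lambda_1\ge\lambda_2\ge\cdots)\vdash n$ let $\ell(\lambda)$ be its number of parts, put $\lambda_i=0$ for $i>\ell(\lambda)$, and let $\lambda'$ be the dual partition. Let $X^\lambda$ be the irreducible character of the symmetric group $\mathfrak S_n$ indexed by $\lambda$, i.e. the character of the left ideal of $\mathbb C[\mathfrak S_n]$ generated by a Young symmetrizer of shape $\lambda$ (so $X^{(n)}$ is trivial and $X^{(1^n)}$ is the sign); $X^\lambda(\tau)$ denotes its value at permutations of cycle type $\tau\vdash n$. For a polynomial $f$ put $X^\lambda(f)=X^\lambda(\tau_f)$ if $f$ is squarefree of degree $n$, where $\tau_f$ is the partition of $n$ formed by the degrees of the prime factors of $f$, and $X^\lambda(f)=0$ otherwise. Let $s_\lambda(\omega_1,\dots,\omega_k)$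 be the Schur polynomial: the polynomial equal to $\det(\omega_i^{\lambda_j+k-j})_{i,j=1}^k/\det(\omega_i^{k-j})_{i,j=1}^k$ if $\ell(\lambda)\le k$, and $0$ if $\ell(\lambda)>k$; $s_\lambda(1,\dots,1)$ is its value with all $k$ variables equal to $1$. Then there is a function $b:\mathcal M\to\mathbb C$ with $b(f)=0$ for every squarefree $f$, such that for all $n\ge0$ and all $f\in\mathcal M_n$ $$d_k(f)=\sum_{\substack{\lambda\vdash n\\ \ell(\lambda)\le k}} s_\lambda(\underbrace{1,\dots,1}_{k})\,X^\lambda(f)+b(f).$$ Moreover, for every $n\ge 0$ and every $\lambda\vdash n$: (i) if $\ell(\lambda)\le k$, then $$s_\lambda(\underbrace{1,\dots,1}_{k})=\prod_{1\le i<j\le k}\frac{\lambda_i-\lambda_j+j-i}{j-i};$$ (ii) if $\ell(\lambda)\le k$, then $s_\lambda(\underbrace{1,\dots,1}_{k})=GT_k(\lambda)$, the number of triangular arrays $(x^{(i)}_j)_{1\le i\le k,\ 1\le j\le k+1-i}$ of non-negative integers with $x^{(i)}_j\ge x^{(i+1)}_j\ge x^{(i)}_{j+1}$ for $1\le i\le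 k-1$ and $1\le j\le k-i$, and with top row $x^{(1)}_j=\lambda_j$ for $1\le j\le k$; (iii) $$s_\lambda(\underbrace{1,\dots,1}_{k})=\prod_{u\in\lambda}\frac{k+c(u)}{h(u)},$$ where $u=(i,j)$ runs over the boxes of the Young diagram of $\lambda$ (row $i\ge1$, column $1\le j\le\lambda_i$), $c(u)=j-i$ is the content, and $h(u)=\lambda_i+\lambda'_j-i-j+1$ is the hook length. -/

import Mathlib

namespace FactorizationExpansion

open Polynomial

/-! ### Partitions and Young diagrams -/

/-- The parts of `l` listed in weakly decreasing order. -/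
def sortedParts {n : ℕ} (l : n.Partition) : List ℕ :=
  l.parts.sort (· ≥ ·)

/-- `part l i` is the `i`-th largest part of `l`, counted from `i = 0`,
and `0` for `i` at least the length of `l`. -/
def part {n : ℕ} (l : n.Partition) (i : ℕ) : ℕ :=
  (sortedParts l).getD i 0

/-- The length of a partition: its number of parts. -/
def length {n : ℕ} (l : n.Partition) : ℕ :=
  Multiset.card l.parts

theorem sortedParts_sortedGE {n : ℕ} (l : n.Partition) : (sortedParts l).SortedGE := by
  have h : (sortedParts l).Pairwise (· ≥ ·) := Multiset.pairwise_sort _ _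
  exact h.sortedGE

/-- The Young diagram of a partition: row `i` has `part l i` boxes (rows and columns are
numbered from `0`, and a box is a pair (row, column)). -/
def diagram {n : ℕ} (l : n.Partition) : YoungDiagram :=
  YoungDiagram.ofRowLens (sortedParts l) (sortedParts_sortedGE l)

theorem mem_diagram {n : ℕ} (l : n.Partition) (c : ℕ × ℕ) :
    c ∈ diagram l ↔ c.2 < part l c.1 := by
  unfold diagram part
  rw [YoungDiagram.mem_ofRowLens]
  constructor
  · rintro ⟨h, h'⟩
    rwa [List.getD_eq_getElem _ _ h]
  · intro h
    by_cases hl : c.1 < (sortedParts l).length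
    · refine ⟨hl, ?_⟩
      rwa [List.getD_eq_getElem _ _ hl] at h
    · rw [List.getD_eq_default _ _ (not_lt.mp hl)] at h
      omega

theorem card_cellsOfRowLens (w : List ℕ) :
    (YoungDiagram.cellsOfRowLens w).card = w.sum := by
  induction w with
  | nil => rfl
  | cons a w ih =>
    rw [YoungDiagram.cellsOfRowLens, Finset.card_union_of_disjoint, Finset.card_map, ih]
    · simp
    · rw [Finset.disjoint_left]
      rintro ⟨x, y⟩ h1 h2
      simp at h1 h2
      omega

theorem card_diagram {n : ℕ} (l : n.Partition) : (diagram l).cells.card = n := by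
  have h : (diagram l).cells = YoungDiagram.cellsOfRowLens (sortedParts l) := rfl
  rw [h, card_cellsOfRowLens, ← Multiset.sum_coe, sortedParts, Multiset.sort_eq, l.parts_sum]

/-! ### Irreducible characters of the symmetric group -/

/-- A numbering of the boxes of the Young diagram of `l` by `Fin n`. Any two numberings give
isomorphic representations below. -/
noncomputable def tableau {n : ℕ} (l : n.Partition) : Fin n ≃ (diagram l).cells :=
  Fintype.equivOfCardEq (by rw [Fintype.card_fin, Fintype.card_coe, card_diagram])

open Classical in
/-- The permutations that preserve every row of the tableau. -/
noncomputable def rowGroup {n : ℕ} (l : n.Partition) : Finset (Equiv.Perm (Fin n)) :=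
  Finset.univ.filter fun g => ∀ i, (tableau l (g i)).1.1 = (tableau l i).1.1

open Classical in
/-- The permutations that preserve every column of the tableau. -/
noncomputable def colGroup {n : ℕ} (l : n.Partition) : Finset (Equiv.Perm (Fin n)) :=
  Finset.univ.filter fun g => ∀ i, (tableau l (g i)).1.2 = (tableau l i).1.2

/-- The Young symmetrizer `(∑ p) * (∑ sign q • q)` in the complex group algebra, with `p` running
over the row group and `q` over the column group. -/
noncomputable def youngSymmetrizer {n : ℕ} (l : n.Partition) :
    MonoidAlgebra ℂ (Equiv.Perm (Fin n)) :=
  (∑ p ∈ rowGroup l, MonoidAlgebra.single p 1) *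
    ∑ q ∈ colGroup l, MonoidAlgebra.single q (((Equiv.Perm.sign q : ℤ) : ℂ))

/-- The left ideal of the group algebra generated by the Young symmetrizer: the irreducible
(Specht) module attached to `l`. -/
noncomputable def spechtModule {n : ℕ} (l : n.Partition) :
    Ideal (MonoidAlgebra ℂ (Equiv.Perm (Fin n))) :=
  Ideal.span {youngSymmetrizer l}

/-- The irreducible character of the symmetric group on `n` letters attached to `l`. -/
noncomputable def permCharacter {n : ℕ} (l : n.Partition) (g : Equiv.Perm (Fin n)) : ℂ :=
  (Representation.ofModule' (k := ℂ) (G := Equiv.Perm (Fin n)) (spechtModule l)).character g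

theorem exists_perm_of_type {n : ℕ} (t : n.Partition) :
    ∃ g : Equiv.Perm (Fin n), g.partition.parts = t.parts := by
  obtain ⟨g, hg⟩ := (Equiv.Perm.exists_with_cycleType_iff (Fin n)
    (m := t.parts.filter (2 ≤ ·))).mpr ⟨by
      rw [Fintype.card_fin]
      refine le_of_le_of_eq ?_ t.parts_sum
      conv_rhs => rw [← Multiset.filter_add_not (2 ≤ ·) t.parts, Multiset.sum_add]
      exact Nat.le_add_right _ _, by simp⟩
  refine ⟨g, ?_⟩
  have h1 : t.parts = t.parts.filter (2 ≤ ·) + t.parts.filter (¬ 2 ≤ ·) :=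
    (Multiset.filter_add_not _ _).symm
  have h2 : t.parts.filter (¬ 2 ≤ ·) =
      Multiset.replicate (Multiset.card (t.parts.filter (¬ 2 ≤ ·))) 1 := by
    rw [Multiset.eq_replicate]
    refine ⟨rfl, fun b hb => ?_⟩
    rw [Multiset.mem_filter] at hb
    have := t.parts_pos hb.1
    omega
  have h3 : (t.parts.filter (2 ≤ ·)).sum + Multiset.card (t.parts.filter (¬ 2 ≤ ·)) = n := by
    have h4 : (t.parts.filter (¬ 2 ≤ ·)).sum = Multiset.card (t.parts.filter (¬ 2 ≤ ·)) := by
      conv_lhs => rw [h2]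
      simp
    rw [← h4, ← Multiset.sum_add, ← h1, t.parts_sum]
  rw [Equiv.Perm.parts_partition, ← Equiv.Perm.sum_cycleType, hg, Fintype.card_fin]
  conv_rhs => rw [h1, h2]
  congr 2
  omega

/-- The value of the character attached to `l` at the permutations of cycle type `t`
(fixed points count as cycles of length one). -/
noncomputable def typeCharacter {n : ℕ} (l t : n.Partition) : ℂ :=
  permCharacter l (exists_perm_of_type t).choose

/-! ### Polynomials over a field -/

theorem sum_natDegree_factors {F : Type*} [Field F] {f : F[X]} (hf : f ≠ 0) :
    ((UniqueFactorizationMonoid.factors f).map natDegree).sum = f.natDegree := by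
  have hz : (0 : F[X]) ∉ UniqueFactorizationMonoid.factors f := fun h =>
    (UniqueFactorizationMonoid.prime_of_factor 0 h).ne_zero rfl
  rw [← natDegree_multiset_prod _ hz]
  exact natDegree_eq_of_degree_eq (degree_eq_degree_of_associated
    (UniqueFactorizationMonoid.factors_prod hf))

/-- The factorization type of a squarefree polynomial of degree `n`: the partition of `n` formed
by the degrees of its prime factors (`factors f` lists these up to units, which do not affect
degrees). -/
noncomputable def factorizationType {F : Type*} [Field F] {n : ℕ} (f : F[X])
    (hf : Squarefree f) (hn : f.natDegree = n) : n.Partition where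
  parts := (UniqueFactorizationMonoid.factors f).map natDegree
  parts_pos := by
    intro i hi
    obtain ⟨p, hp, rfl⟩ := Multiset.mem_map.mp hi
    exact (UniqueFactorizationMonoid.irreducible_of_factor p hp).natDegree_pos
  parts_sum := (sum_natDegree_factors hf.ne_zero).trans hn

open Classical in
/-- The character attached to `l`, a partition of `n`, evaluated at a polynomial: its value at the
factorization type if the polynomial is squarefree of degree `n`, and `0` otherwise. -/
noncomputable def polyCharacter {F : Type*} [Field F] {n : ℕ} (l : n.Partition) (f : F[X]) : ℂ :=
  if h : Squarefree f ∧ f.natDegree = n then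
    typeCharacter l (factorizationType f h.1 h.2)
  else 0

/-- The `k`-fold divisor function: the number of `k`-tuples of monic polynomials with
product `f`. -/
noncomputable def divisorFunction {F : Type*} [Field F] (k : ℕ) (f : F[X]) : ℕ :=
  Nat.card {a : Fin k → F[X] // (∀ i, (a i).Monic) ∧ ∏ i, a i = f}

/-! ### Schur polynomials -/

/-- The `k × k` determinant with entries `x_i ^ (a_j + k - 1 - j)`, for `i, j` counted from `0`. -/
noncomputable def alternant (k : ℕ) (a : ℕ → ℕ) : MvPolynomial (Fin k) ℤ :=
  Matrix.det (Matrix.of fun i j : Fin k =>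
    (MvPolynomial.X i : MvPolynomial (Fin k) ℤ) ^ (a j + (k - 1 - (j : ℕ))))

/-- The Vandermonde-type denominator divides every alternant. -/
theorem alternant_zero_dvd (k : ℕ) (a : ℕ → ℕ) : alternant k (fun _ => 0) ∣ alternant k a := by
  classical
  set P : (MvPolynomial (Fin k) ℤ)[X] := ∏ i : Fin k, (X - C (MvPolynomial.X i)) with hP
  have hmon : P.Monic := monic_prod_of_monic _ _ fun i _ => monic_X_sub_C _
  have hdeg : P.natDegree = k := by
    rw [hP, natDegree_prod_of_monic _ _ fun i _ => monic_X_sub_C _]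
    simp
  have hroot : ∀ i : Fin k, P.eval (MvPolynomial.X i) = 0 := by
    intro i
    rw [hP, eval_prod]
    exact Finset.prod_eq_zero (Finset.mem_univ i) (by simp)
  set r : ℕ → (MvPolynomial (Fin k) ℤ)[X] := fun e => X ^ e %ₘ P with hr
  have hval : ∀ (i : Fin k) (e : ℕ), (MvPolynomial.X i : MvPolynomial (Fin k) ℤ) ^ e =
      ∑ j : Fin k, (MvPolynomial.X i) ^ (k - 1 - (j : ℕ)) * (r e).coeff (k - 1 - (j : ℕ)) := by
    intro i e
    have h1 : (r e).eval (MvPolynomial.X i) = (MvPolynomial.X i) ^ e := by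
      have h2 := congrArg (eval (MvPolynomial.X i)) (modByMonic_add_div (X ^ e) P)
      rw [eval_add, eval_mul, hroot, zero_mul, add_zero, eval_pow, eval_X] at h2
      exact h2
    have hk : 0 < k := i.pos
    have h3 : (r e).natDegree < k := by
      have := natDegree_modByMonic_lt (X ^ e) hmon (fun h => by
        rw [h, natDegree_one] at hdeg
        omega)
      rwa [hdeg] at this
    rw [← h1, eval_eq_sum_range' h3, ← Finset.sum_range_reflect, ← Fin.sum_univ_eq_sum_range
      (fun j => (r e).coeff (k - 1 - j) * (MvPolynomial.X i) ^ (k - 1 - j)) k]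
    exact Finset.sum_congr rfl fun j _ => mul_comm _ _
  refine ⟨Matrix.det (Matrix.of fun i j : Fin k =>
    (r (a j + (k - 1 - (j : ℕ)))).coeff (k - 1 - (i : ℕ))), ?_⟩
  unfold alternant
  rw [← Matrix.det_mul]
  congr 1
  ext1 i j
  rw [Matrix.mul_apply, Matrix.of_apply, hval]
  simp

/-- The Schur polynomial of `l` in `k` variables: the quotient of alternants, which is a
polynomial, if `l` has length at most `k`, and `0` otherwise. -/
noncomputable def schurPoly {n : ℕ} (k : ℕ) (l : n.Partition) : MvPolynomial (Fin k) ℤ :=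
  if length l ≤ k then (alternant_zero_dvd k (part l)).choose else 0

/-- The defining property of the quotient. -/
theorem alternant_mul_schurPoly {n : ℕ} (k : ℕ) (l : n.Partition) (h : length l ≤ k) :
    alternant k (part l) = alternant k (fun _ => 0) * schurPoly k l := by
  rw [schurPoly, if_pos h]
  exact (alternant_zero_dvd k (part l)).choose_spec

/-- The Schur polynomial of `l` in `k` variables with all variables set to `1`. -/
noncomputable def schurAtOne {n : ℕ} (k : ℕ) (l : n.Partition) : ℤ :=
  MvPolynomial.eval (fun _ => 1) (schurPoly k l)

/-! ### Gelfand–Tsetlin patterns, contents and hook lengths -/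

/-- Triangular arrays `x i j` of non-negative integers, `i + j < k` (row `i` has `k - i` entries;
rows and positions are numbered from `0`), with interlacing rows and top row `l`, padded by zeros.
Outside the triangle `x` is `0`. -/
def gtPatterns {n : ℕ} (k : ℕ) (l : n.Partition) : Set (ℕ → ℕ → ℕ) :=
  {x | (∀ i j, k ≤ i + j → x i j = 0) ∧
    (∀ j, j < k → x 0 j = part l j) ∧
    ∀ i j, i + j + 1 < k → x (i + 1) j ≤ x i j ∧ x i (j + 1) ≤ x (i + 1) j}

/-- The number of Gelfand–Tsetlin patterns with `k` rows and top row `l`. -/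
noncomputable def gtCount {n : ℕ} (k : ℕ) (l : n.Partition) : ℕ :=
  (gtPatterns k l).ncard

/-- The content of a box: column minus row. -/
def content (u : ℕ × ℕ) : ℤ :=
  (u.2 : ℤ) - (u.1 : ℤ)

/-- The hook length of a box: the number of boxes weakly to its right in its row plus the number
of boxes strictly below it in its column. -/
def hookLength {n : ℕ} (l : n.Partition) (u : ℕ × ℕ) : ℤ :=
  (part l u.1 : ℤ) + ((diagram l).colLen u.2 : ℤ) - u.1 - u.2 - 1

end FactorizationExpansion

open FactorizationExpansion

namespace FactorizationExpansion

open Polynomial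

/-! ### Sums of distinct naturals -/

/-! A squarefree `f` with `r` prime factors has `d_k(f) = k ^ r` (`divisorFunction_of_squarefree`),
since each prime is assigned to one of the `k` entries. If `g` has the factorization type of `f` as
cycle type, `k ^ r` is also the number of words of length `n` over `k` letters fixed by `g`
(`fixedWords_eq_pow`), that is, the permutation character on words. So the expansion amounts to
saying that the multiplicity of the irreducible character of shape `l` in this character is the
Schur polynomial at one (`multiplicity_eq_schurAtOne`). At non-squarefree `f` all characters vanish
and `b` takes the whole value.

Orthogonality of the characters comes from Young symmetrizers `c`: they satisfy `c x c ∈ ℂ c`, and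
different shapes annihilate each other in a suitable order. Shapes are compared by the sum of the
row indices of their boxes, a total preorder which does the work of dominance. Characters and
conjugacy classes are both indexed by partitions, so orthogonality already gives completeness
(`classFunction_eq_sum`).

The multiplicities are found by a squeeze. Let `N l` be the multiplicity in words and `f l` the
degree of the character. Both are ranks of idempotents, bounded below by triangularity
(`exists_multiplicity`): `N l` by the number of semistandard fillings, hence by the number of
Gelfand–Tsetlin patterns, which is the Schur value; `f l` by the number of standard fillings, hence
by the number of ballot words of content `l`. At the identity, `∑ N l * f l = k ^ n`. Iterating the
one-box Pieri rule gives the same total for Schur values times numbers of ballot words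
(`sum_ballot_schurValue`). So every inequality is an equality termwise, and `f l > 0` yields `N l`.

For the formulas, the substitution `x_i = X ^ i` turns alternants into Vandermonde products, and
letting `X` tend to one gives the Weyl product (`prod_shifted_eq`). Rewriting that product as a
determinant of binomial coefficients gives the branching rule (`sum_interlacing_schurValue`), which
counts patterns row by row. In each row, hook lengths and the differences in the Weyl product
together fill an interval of integers (`prod_hook_mul_prod_sub`), which gives the hook-content
formula. -/

/-- Elements of `s` outside the initial segment are at least `s.card`, and the equally many missing
ones are smaller, so each exchange gains at least one. The extra term detects equality. -/
theorem sum_range_card_add_card_sdiff_le (s : Finset ℕ) :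
    ∑ i ∈ Finset.range s.card, i + (s \ Finset.range s.card).card ≤ ∑ i ∈ s, i := by
  set r := Finset.range s.card with hr
  have hc : (s \ r).card = (r \ s).card := by
    have h1 := Finset.card_sdiff_add_card_inter s r
    have h2 := Finset.card_sdiff_add_card_inter r s
    rw [Finset.inter_comm] at h2
    have h3 : r.card = s.card := by simp [hr]
    omega
  have h1 : ∑ i ∈ s \ r, i + ∑ i ∈ s ∩ r, i = ∑ i ∈ s, i := by
    rw [add_comm]; exact Finset.sum_inter_add_sum_sdiff s r _
  have h2 : ∑ i ∈ r \ s, i + ∑ i ∈ s ∩ r, i = ∑ i ∈ r, i := by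
    rw [add_comm, Finset.inter_comm]; exact Finset.sum_inter_add_sum_sdiff r s _
  have h3 : (s \ r).card * s.card ≤ ∑ i ∈ s \ r, i := by
    rw [← smul_eq_mul]
    refine Finset.card_nsmul_le_sum _ _ _ fun i hi => ?_
    simp only [hr, Finset.mem_sdiff, Finset.mem_range, not_lt] at hi
    exact hi.2
  have h4 : ∑ i ∈ r \ s, (i + 1) ≤ (r \ s).card * s.card := by
    rw [← smul_eq_mul]
    refine Finset.sum_le_card_nsmul _ _ _ fun i hi => ?_
    simp only [hr, Finset.mem_sdiff, Finset.mem_range] at hi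
    exact hi.1
  rw [Finset.sum_add_distrib, Finset.sum_const, smul_eq_mul, mul_one] at h4
  rw [← hc] at h4
  omega

/-! ### Rows and columns of the tableau -/

/-- The row of the box numbered `i`. -/
noncomputable def rowOf {n : ℕ} (l : n.Partition) (i : Fin n) : ℕ := (tableau l i).1.1

/-- The column of the box numbered `i`. -/
noncomputable def colOf {n : ℕ} (l : n.Partition) (i : Fin n) : ℕ := (tableau l i).1.2

theorem box_mem {n : ℕ} (l : n.Partition) (i : Fin n) : (rowOf l i, colOf l i) ∈ diagram l :=
  (tableau l i).2

theorem box_injective {n : ℕ} (l : n.Partition) {i j : Fin n} (hr : rowOf l i = rowOf l j)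
    (hc : colOf l i = colOf l j) : i = j :=
  (tableau l).injective (Subtype.ext (Prod.ext hr hc))

theorem exists_box {n : ℕ} (l : n.Partition) {u : ℕ × ℕ} (hu : u ∈ diagram l) :
    ∃ i, rowOf l i = u.1 ∧ colOf l i = u.2 :=
  ⟨(tableau l).symm ⟨u, hu⟩, by simp [rowOf], by simp [colOf]⟩

theorem mem_rowGroup {n : ℕ} {l : n.Partition} {g : Equiv.Perm (Fin n)} :
    g ∈ rowGroup l ↔ ∀ i, rowOf l (g i) = rowOf l i := by
  simp [rowGroup, rowOf]

theorem mem_colGroup {n : ℕ} {l : n.Partition} {g : Equiv.Perm (Fin n)} :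
    g ∈ colGroup l ↔ ∀ i, colOf l (g i) = colOf l i := by
  simp [colGroup, colOf]

theorem sum_boxes {n : ℕ} (l : n.Partition) {M : Type*} [AddCommMonoid M] (f : ℕ × ℕ → M) :
    ∑ i, f (rowOf l i, colOf l i) = ∑ u ∈ (diagram l).cells, f u := by
  rw [← Finset.sum_coe_sort (diagram l).cells]
  exact Fintype.sum_equiv (tableau l) _ _ fun i => rfl

theorem part_eq_rowLen {n : ℕ} (l : n.Partition) (r : ℕ) : part l r = (diagram l).rowLen r := by
  refine eq_of_forall_lt_iff ?_
  intro j
  rw [← YoungDiagram.mem_iff_lt_rowLen, mem_diagram]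

theorem card_rowOf {n : ℕ} (l : n.Partition) (r : ℕ) :
    (Finset.univ.filter fun i => rowOf l i = r).card = part l r := by
  rw [Finset.card_filter, sum_boxes l (fun u => if u.1 = r then 1 else 0), ← Finset.card_filter,
    part_eq_rowLen, YoungDiagram.rowLen_eq_card]
  rfl

theorem card_colOf {n : ℕ} (l : n.Partition) (c : ℕ) :
    (Finset.univ.filter fun i => colOf l i = c).card = (diagram l).colLen c := by
  rw [Finset.card_filter, sum_boxes l (fun u => if u.2 = c then 1 else 0), ← Finset.card_filter,
    YoungDiagram.colLen_eq_card]
  rfl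

theorem eq_of_part_eq {n : ℕ} {l m : n.Partition} (h : part l = part m) : l = m := by
  have hd : diagram l = diagram m := by
    ext u
    rw [YoungDiagram.mem_cells, YoungDiagram.mem_cells, mem_diagram, mem_diagram, h]
  have hs : sortedParts l = sortedParts m := by
    have hl : ∀ l : n.Partition, (diagram l).rowLens = sortedParts l := fun l =>
      YoungDiagram.rowLens_ofRowLens_eq_self (fun x hx =>
        l.parts_pos (by rwa [sortedParts, Multiset.mem_sort] at hx))
    rw [← hl l, ← hl m, hd]
  apply Nat.Partition.ext
  rw [← Multiset.sort_eq l.parts (· ≥ ·), ← Multiset.sort_eq m.parts (· ≥ ·)]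
  exact congrArg _ hs

/-- The sum of the row indices of all boxes. -/
noncomputable def rowSum {n : ℕ} (l : n.Partition) : ℕ := ∑ i, rowOf l i

/-- If the rows of one tableau and the columns of another one separate points, then the first shape
has at least the row sum of the second one, and in case of equality the pairs (row, column) are the
boxes of the second shape. -/
theorem rowSum_le_and_mem {n : ℕ} (l m : n.Partition) (s : Equiv.Perm (Fin n))
    (hinj : Function.Injective fun i => (rowOf l i, colOf m (s i))) :
    rowSum m ≤ rowSum l ∧
      (rowSum l ≤ rowSum m → ∀ i, (rowOf l i, colOf m (s i)) ∈ diagram m) := by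
  classical
  set N := Finset.univ.image (colOf m) with hN
  -- `S c` holds the rows of `l` met by the entries that `s` sends to column `c` of `m`. Separation
  -- gives it as many elements as that column has boxes, while column `c` of `m` itself meets an
  -- initial segment of rows.
  set S : ℕ → Finset ℕ := fun c =>
    (Finset.univ.filter fun i => colOf m (s i) = c).image (rowOf l) with hS
  have hinjOn : ∀ c, Set.InjOn (rowOf l) (Finset.univ.filter fun i => colOf m (s i) = c) := by
    intro c i hi j hj hij
    simp only [Finset.coe_filter, Finset.mem_univ, true_and, Set.mem_ofPred_eq] at hi hj
    exact hinj (Prod.ext hij (hi.trans hj.symm))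
  have hcard : ∀ c, (S c).card = (diagram m).colLen c := by
    intro c
    rw [hS, Finset.card_image_of_injOn (hinjOn c), ← card_colOf]
    refine Finset.card_bij (fun i _ => s i) (by simp) (by simp) ?_
    intro b hb
    exact ⟨s.symm b, by simpa using hb, by simp⟩
  have h1 : ∑ c ∈ N, ∑ r ∈ S c, r = rowSum l := by
    rw [rowSum, ← Finset.sum_fiberwise_of_maps_to (s := Finset.univ) (t := N)
      (g := fun i => colOf m (s i)) (by simp [hN])]
    exact Finset.sum_congr rfl fun c _ => Finset.sum_image (hinjOn c)
  have h2 : ∑ c ∈ N, ∑ r ∈ Finset.range (S c).card, r = rowSum m := by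
    rw [rowSum, ← Finset.sum_fiberwise_of_maps_to (s := Finset.univ) (t := N)
      (g := fun i => colOf m i) (by simp [hN])]
    refine Finset.sum_congr rfl fun c _ => ?_
    rw [hcard]
    symm
    refine Finset.sum_bij (fun i _ => rowOf m i) ?_ ?_ ?_ ?_
    · intro i hi
      have := box_mem m i
      rw [YoungDiagram.mem_iff_lt_colLen] at this
      simp only [Finset.mem_filter, Finset.mem_univ, true_and] at hi
      rw [Finset.mem_range, ← hi]
      exact this
    · intro i hi j hj hij
      simp only [Finset.mem_filter, Finset.mem_univ, true_and] at hi hj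
      exact box_injective m hij (hi.trans hj.symm)
    · intro r hr
      rw [Finset.mem_range, ← YoungDiagram.mem_iff_lt_colLen] at hr
      obtain ⟨i, hi1, hi2⟩ := exists_box m hr
      exact ⟨i, by simpa using hi2, hi1⟩
    · intro i _
      rfl
  have h3 : rowSum m + ∑ c ∈ N, (S c \ Finset.range (S c).card).card ≤ rowSum l := by
    rw [← h1, ← h2, ← Finset.sum_add_distrib]
    exact Finset.sum_le_sum fun c _ => sum_range_card_add_card_sdiff_le _
  refine ⟨by omega, fun hle i => ?_⟩
  have h4 : ∑ c ∈ N, (S c \ Finset.range (S c).card).card = 0 := by omega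
  rw [Finset.sum_eq_zero_iff] at h4
  have h5 := h4 (colOf m (s i)) (by simp [hN])
  rw [Finset.card_eq_zero, Finset.sdiff_eq_empty_iff_subset] at h5
  have h6 : rowOf l i ∈ S (colOf m (s i)) := by
    rw [hS]
    exact Finset.mem_image.mpr ⟨i, by simp, rfl⟩
  have h7 := h5 h6
  rw [Finset.mem_range, hcard, ← YoungDiagram.mem_iff_lt_colLen] at h7
  exact h7

/-- In the equality case the pairs (row, column) give a row-preserving bijection between the boxes
of the two shapes, so the row lengths agree. -/
theorem eq_of_separating {n : ℕ} (l m : n.Partition) (s : Equiv.Perm (Fin n))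
    (hinj : Function.Injective fun i => (rowOf l i, colOf m (s i)))
    (hle : rowSum l ≤ rowSum m) : l = m := by
  classical
  have hmem := (rowSum_le_and_mem l m s hinj).2 hle
  let f : Fin n → Fin n := fun i => (tableau m).symm ⟨_, hmem i⟩
  have hf : ∀ i, rowOf m (f i) = rowOf l i := fun i => by simp [f, rowOf]
  have hinjf : Function.Injective f := fun i j hij => hinj (by
    simpa [f] using hij)
  let e := Equiv.ofBijective f (Finite.injective_iff_bijective.mp hinjf)
  apply eq_of_part_eq
  funext r
  rw [← card_rowOf, ← card_rowOf]
  refine Finset.card_bij (fun i _ => f i) (by simp [hf]) (fun i _ j _ h => hinjf h) ?_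
  intro b hb
  refine ⟨e.symm b, ?_, e.apply_symm_apply b⟩
  have h1 : f (e.symm b) = b := e.apply_symm_apply b
  simp only [Finset.mem_filter, Finset.mem_univ, true_and] at hb ⊢
  rw [← hf, h1, hb]

/-- A permutation that never brings two boxes of a row into one column is a product of an element
of the row group and an element of the column group. -/
theorem exists_row_mul_col {n : ℕ} (l : n.Partition) (s : Equiv.Perm (Fin n))
    (hinj : Function.Injective fun i => (rowOf l i, colOf l (s i))) :
    ∃ p ∈ rowGroup l, ∃ q ∈ colGroup l, s⁻¹ = p * q := by
  classical
  have hmem := (rowSum_le_and_mem l l s hinj).2 le_rfl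
  let f : Fin n → Fin n := fun i => (tableau l).symm ⟨_, hmem i⟩
  have hf : ∀ i, rowOf l (f i) = rowOf l i := fun i => by simp [f, rowOf]
  have hf' : ∀ i, colOf l (f i) = colOf l (s i) := fun i => by simp [f, colOf]
  have hinjf : Function.Injective f := fun i j hij => hinj (by
    simpa [f] using hij)
  -- `e` moves each box along its own row to the column where `s` sends it, so `e` preserves rows
  -- and `e * s⁻¹` preserves columns.
  let e : Equiv.Perm (Fin n) := Equiv.ofBijective f (Finite.injective_iff_bijective.mp hinjf)
  have he : ∀ i, e i = f i := fun i => rfl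
  refine ⟨e⁻¹, ?_, e * s⁻¹, ?_, by group⟩
  · rw [mem_rowGroup]
    intro i
    rw [← hf (e⁻¹ i), ← he]
    simp
  · rw [mem_colGroup]
    intro i
    rw [Equiv.Perm.mul_apply, he, hf']
    simp

/-! ### Young symmetrizers -/

/-- The sum of the elements of the row group. -/
noncomputable def rowSymmetrizer {n : ℕ} (l : n.Partition) :
    MonoidAlgebra ℂ (Equiv.Perm (Fin n)) :=
  ∑ p ∈ rowGroup l, MonoidAlgebra.single p 1

/-- The signed sum of the elements of the column group. -/
noncomputable def colAntisymmetrizer {n : ℕ} (l : n.Partition) :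
    MonoidAlgebra ℂ (Equiv.Perm (Fin n)) :=
  ∑ q ∈ colGroup l, MonoidAlgebra.single q (((Equiv.Perm.sign q : ℤ) : ℂ))

theorem youngSymmetrizer_eq {n : ℕ} (l : n.Partition) :
    youngSymmetrizer l = rowSymmetrizer l * colAntisymmetrizer l := rfl

theorem one_mem_rowGroup {n : ℕ} (l : n.Partition) : 1 ∈ rowGroup l := by
  simp [mem_rowGroup]

theorem one_mem_colGroup {n : ℕ} (l : n.Partition) : 1 ∈ colGroup l := by
  simp [mem_colGroup]

theorem mul_mem_rowGroup {n : ℕ} {l : n.Partition} {g h : Equiv.Perm (Fin n)}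
    (hg : g ∈ rowGroup l) (hh : h ∈ rowGroup l) : g * h ∈ rowGroup l := by
  rw [mem_rowGroup] at *
  intro i
  rw [Equiv.Perm.mul_apply, hg, hh]

theorem mul_mem_colGroup {n : ℕ} {l : n.Partition} {g h : Equiv.Perm (Fin n)}
    (hg : g ∈ colGroup l) (hh : h ∈ colGroup l) : g * h ∈ colGroup l := by
  rw [mem_colGroup] at *
  intro i
  rw [Equiv.Perm.mul_apply, hg, hh]

theorem inv_mem_rowGroup {n : ℕ} {l : n.Partition} {g : Equiv.Perm (Fin n)}
    (hg : g ∈ rowGroup l) : g⁻¹ ∈ rowGroup l := by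
  rw [mem_rowGroup] at *
  intro i
  rw [← hg (g⁻¹ i)]
  simp

theorem inv_mem_colGroup {n : ℕ} {l : n.Partition} {g : Equiv.Perm (Fin n)}
    (hg : g ∈ colGroup l) : g⁻¹ ∈ colGroup l := by
  rw [mem_colGroup] at *
  intro i
  rw [← hg (g⁻¹ i)]
  simp

theorem swap_mem_rowGroup {n : ℕ} {l : n.Partition} {i j : Fin n} (h : rowOf l i = rowOf l j) :
    Equiv.swap i j ∈ rowGroup l := by
  rw [mem_rowGroup]
  intro k
  by_cases h1 : k = i
  · subst h1; simp [h]
  by_cases h2 : k = j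
  · subst h2; simp [h]
  rw [Equiv.swap_apply_of_ne_of_ne h1 h2]

theorem swap_mem_colGroup {n : ℕ} {l : n.Partition} {i j : Fin n} (h : colOf l i = colOf l j) :
    Equiv.swap i j ∈ colGroup l := by
  rw [mem_colGroup]
  intro k
  by_cases h1 : k = i
  · subst h1; simp [h]
  by_cases h2 : k = j
  · subst h2; simp [h]
  rw [Equiv.swap_apply_of_ne_of_ne h1 h2]

theorem single_mul_rowSymmetrizer {n : ℕ} {l : n.Partition} {p : Equiv.Perm (Fin n)}
    (hp : p ∈ rowGroup l) : MonoidAlgebra.single p 1 * rowSymmetrizer l = rowSymmetrizer l := by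
  rw [rowSymmetrizer, Finset.mul_sum]
  refine Finset.sum_bij' (fun a _ => p * a) (fun a _ => p⁻¹ * a)
    (fun a ha => mul_mem_rowGroup hp ha) (fun a ha => mul_mem_rowGroup (inv_mem_rowGroup hp) ha)
    (by simp) (by simp) ?_
  intro a _
  rw [MonoidAlgebra.single_mul_single, one_mul]

theorem rowSymmetrizer_mul_single {n : ℕ} {l : n.Partition} {p : Equiv.Perm (Fin n)}
    (hp : p ∈ rowGroup l) : rowSymmetrizer l * MonoidAlgebra.single p 1 = rowSymmetrizer l := by
  rw [rowSymmetrizer, Finset.sum_mul]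
  refine Finset.sum_bij' (fun a _ => a * p) (fun a _ => a * p⁻¹)
    (fun a ha => mul_mem_rowGroup ha hp) (fun a ha => mul_mem_rowGroup ha (inv_mem_rowGroup hp))
    (by simp) (by simp) ?_
  intro a _
  rw [MonoidAlgebra.single_mul_single, one_mul]

theorem sign_mul_sign_self {n : ℕ} (q : Equiv.Perm (Fin n)) :
    ((Equiv.Perm.sign q : ℤ) : ℂ) * ((Equiv.Perm.sign q : ℤ) : ℂ) = 1 := by
  rw [← Int.cast_mul, ← Units.val_mul, Int.units_mul_self]
  simp

theorem single_mul_colAntisymmetrizer {n : ℕ} {l : n.Partition} {q : Equiv.Perm (Fin n)}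
    (hq : q ∈ colGroup l) : MonoidAlgebra.single q 1 * colAntisymmetrizer l =
      ((Equiv.Perm.sign q : ℤ) : ℂ) • colAntisymmetrizer l := by
  rw [colAntisymmetrizer, Finset.mul_sum, Finset.smul_sum]
  refine Finset.sum_bij' (fun a _ => q * a) (fun a _ => q⁻¹ * a)
    (fun a ha => mul_mem_colGroup hq ha) (fun a ha => mul_mem_colGroup (inv_mem_colGroup hq) ha)
    (by simp) (by simp) ?_
  intro a _
  rw [MonoidAlgebra.single_mul_single, one_mul, MonoidAlgebra.smul_single, smul_eq_mul,
    Equiv.Perm.sign_mul, Units.val_mul, Int.cast_mul, ← mul_assoc, sign_mul_sign_self, one_mul]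

theorem colAntisymmetrizer_mul_single {n : ℕ} {l : n.Partition} {q : Equiv.Perm (Fin n)}
    (hq : q ∈ colGroup l) : colAntisymmetrizer l * MonoidAlgebra.single q 1 =
      ((Equiv.Perm.sign q : ℤ) : ℂ) • colAntisymmetrizer l := by
  rw [colAntisymmetrizer, Finset.sum_mul, Finset.smul_sum]
  refine Finset.sum_bij' (fun a _ => a * q) (fun a _ => a * q⁻¹)
    (fun a ha => mul_mem_colGroup ha hq) (fun a ha => mul_mem_colGroup ha (inv_mem_colGroup hq))
    (by simp) (by simp) ?_
  intro a _
  rw [MonoidAlgebra.single_mul_single, mul_one, MonoidAlgebra.smul_single, smul_eq_mul,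
    Equiv.Perm.sign_mul, Units.val_mul, Int.cast_mul, mul_comm (((Equiv.Perm.sign a : ℤ)) : ℂ),
    ← mul_assoc, sign_mul_sign_self, one_mul]

theorem sign_swap_cast {n : ℕ} {i j : Fin n} (h : i ≠ j) :
    ((Equiv.Perm.sign (Equiv.swap i j) : ℤ) : ℂ) = -1 := by
  rw [Equiv.Perm.sign_swap h]
  simp

/-- For a group element `g`, some two entries share a row of `l` while their images under `g⁻¹`
share a column of `m`. Their transposition is absorbed on the left and, moved through `g`, gives a
factor `-1` on the right. -/
theorem rowSymmetrizer_mul_mul_colAntisymmetrizer {n : ℕ} {l m : n.Partition} (hne : l ≠ m)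
    (hle : rowSum l ≤ rowSum m) (x : MonoidAlgebra ℂ (Equiv.Perm (Fin n))) :
    rowSymmetrizer l * x * colAntisymmetrizer m = 0 := by
  induction x using MonoidAlgebra.induction_linear with
  | zero => simp
  | add x y hx hy => rw [mul_add, add_mul, hx, hy, add_zero]
  | single g r =>
    have hni : ¬ Function.Injective fun i => (rowOf l i, colOf m (g⁻¹ i)) := fun h =>
      hne (eq_of_separating l m g⁻¹ h hle)
    simp only [Function.Injective, not_forall, Prod.mk.injEq] at hni
    obtain ⟨i, j, ⟨hr, hc⟩, hij⟩ := hni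
    have h1 : MonoidAlgebra.single (Equiv.swap i j) 1 * MonoidAlgebra.single g r =
        MonoidAlgebra.single g r *
          MonoidAlgebra.single (Equiv.swap (g⁻¹ i) (g⁻¹ j)) (1 : ℂ) := by
      rw [MonoidAlgebra.single_mul_single, MonoidAlgebra.single_mul_single, one_mul, mul_one,
        Equiv.mul_swap_eq_swap_mul]
      simp
    have h2 : rowSymmetrizer l * MonoidAlgebra.single g r * colAntisymmetrizer m =
        -(rowSymmetrizer l * MonoidAlgebra.single g r * colAntisymmetrizer m) := by
      conv_lhs => rw [← rowSymmetrizer_mul_single (swap_mem_rowGroup hr), mul_assoc _ _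
        (MonoidAlgebra.single g r), h1, ← mul_assoc, mul_assoc _ _ (colAntisymmetrizer m),
        single_mul_colAntisymmetrizer (swap_mem_colGroup hc),
        sign_swap_cast (fun h => hij (g⁻¹.injective h)), mul_smul_comm, neg_one_smul]
    ext a
    have h3 := congrArg (fun y => y.coeff a) h2
    exact self_eq_neg.mp h3

/-- Row group and column group meet only in the identity, so the identity arises from a single
product. -/
theorem coeff_youngSymmetrizer_one {n : ℕ} (l : n.Partition) :
    (youngSymmetrizer l).coeff 1 = 1 := by
  classical
  have h : ∀ p ∈ rowGroup l, ∀ q ∈ colGroup l, p * q = 1 → p = 1 ∧ q = 1 := by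
    intro p hp q hq hpq
    have h1 : q = 1 := by
      have hq' : q ∈ rowGroup l := by
        rw [← inv_eq_of_mul_eq_one_right hpq]
        exact inv_mem_rowGroup hp
      rw [mem_rowGroup] at hq'
      rw [mem_colGroup] at hq
      ext1 i
      exact box_injective l (hq' i) (hq i)
    exact ⟨by rwa [h1, mul_one] at hpq, h1⟩
  rw [youngSymmetrizer, Finset.sum_mul_sum, MonoidAlgebra.coeff_sum, Finset.sum_apply',
    Finset.sum_eq_single 1, MonoidAlgebra.coeff_sum, Finset.sum_apply', Finset.sum_eq_single 1]
  · rw [MonoidAlgebra.single_mul_single]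
    simp
  · intro q hq hq1
    rw [MonoidAlgebra.single_mul_single, MonoidAlgebra.coeff_single, Finsupp.single_eq_of_ne]
    exact fun h' => hq1 (h 1 (one_mem_rowGroup l) q hq h'.symm).2
  · exact fun h' => absurd (one_mem_colGroup l) h'
  · intro p hp hp1
    rw [MonoidAlgebra.coeff_sum, Finset.sum_apply', Finset.sum_eq_zero]
    intro q hq
    rw [MonoidAlgebra.single_mul_single, MonoidAlgebra.coeff_single, Finsupp.single_eq_of_ne]
    exact fun h' => hp1 (h p hp q hq h'.symm).1
  · exact fun h' => absurd (one_mem_rowGroup l) h'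

/-- The coefficient at a product `p * q` of row and column elements is, up to sign, the one at the
identity. Any other `g` satisfies `t * g = g * t'` with a row transposition `t` and a column
transposition `t'`, so its coefficient equals its own negative. -/
theorem eq_zero_of_invariant {n : ℕ} (l : n.Partition) (x : MonoidAlgebra ℂ (Equiv.Perm (Fin n)))
    (hr : ∀ p ∈ rowGroup l, MonoidAlgebra.single p 1 * x = x)
    (hc : ∀ q ∈ colGroup l, x * MonoidAlgebra.single q 1 = ((Equiv.Perm.sign q : ℤ) : ℂ) • x)
    (h1 : x.coeff 1 = 0) : x = 0 := by
  have hr' : ∀ p ∈ rowGroup l, ∀ g, x.coeff (p * g) = x.coeff g := by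
    intro p hp g
    conv_lhs => rw [← hr p hp]
    simp [MonoidAlgebra.coeff_single_mul_apply]
  have hc' : ∀ q ∈ colGroup l, ∀ g,
      x.coeff (g * q) = ((Equiv.Perm.sign q : ℤ) : ℂ) * x.coeff g := by
    intro q hq g
    have h := congrArg (fun y => y.coeff (g * q)) (hc q hq)
    simp only [MonoidAlgebra.coeff_mul_single_apply, MonoidAlgebra.coeff_smul_apply] at h
    rw [mul_inv_cancel_right, mul_one, smul_eq_mul] at h
    rw [h, ← mul_assoc, sign_mul_sign_self, one_mul]
  ext g
  rw [MonoidAlgebra.coeff_zero, Finsupp.zero_apply]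
  by_cases hinj : Function.Injective fun i => (rowOf l i, colOf l (g⁻¹ i))
  · obtain ⟨p, hp, q, hq, hpq⟩ := exists_row_mul_col l g⁻¹ hinj
    rw [inv_inv] at hpq
    rw [hpq, hr' p hp, ← one_mul q, hc' q hq, h1, mul_zero]
  · simp only [Function.Injective, not_forall, Prod.mk.injEq] at hinj
    obtain ⟨i, j, ⟨hr0, hc0⟩, hij⟩ := hinj
    have h2 := hr' _ (swap_mem_rowGroup hr0) g
    have h3 : Equiv.swap i j * g = g * Equiv.swap (g⁻¹ i) (g⁻¹ j) := by
      rw [Equiv.mul_swap_eq_swap_mul]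
      simp
    rw [h3, hc' _ (swap_mem_colGroup hc0), sign_swap_cast (fun h => hij (g⁻¹.injective h)),
      neg_one_mul] at h2
    exact self_eq_neg.mp h2.symm

/-- The sandwich property of the Young symmetrizer. -/
theorem youngSymmetrizer_mul_mul {n : ℕ} (l : n.Partition)
    (x : MonoidAlgebra ℂ (Equiv.Perm (Fin n))) :
    youngSymmetrizer l * x * youngSymmetrizer l =
      (youngSymmetrizer l * x * youngSymmetrizer l).coeff 1 • youngSymmetrizer l := by
  set c := youngSymmetrizer l with hcdef
  have hl : ∀ p ∈ rowGroup l, MonoidAlgebra.single p 1 * c = c := fun p hp => by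
    rw [hcdef, youngSymmetrizer_eq, ← mul_assoc, single_mul_rowSymmetrizer hp]
  have hr : ∀ q ∈ colGroup l, c * MonoidAlgebra.single q 1 =
      ((Equiv.Perm.sign q : ℤ) : ℂ) • c := fun q hq => by
    rw [hcdef, youngSymmetrizer_eq, mul_assoc, colAntisymmetrizer_mul_single hq, mul_smul_comm]
  -- The difference of the two sides has the invariance of `c`, and its coefficient at the identity
  -- vanishes because that of `c` is one.
  rw [← sub_eq_zero]
  refine eq_zero_of_invariant l _ ?_ ?_ ?_
  · intro p hp
    rw [mul_sub, ← mul_assoc, ← mul_assoc, hl p hp, mul_smul_comm, hl p hp]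
  · intro q hq
    rw [sub_mul, mul_assoc _ c, hr q hq, smul_mul_assoc, hr q hq, smul_sub, mul_smul_comm,
      smul_comm]
  · rw [MonoidAlgebra.coeff_sub, Finsupp.sub_apply, MonoidAlgebra.coeff_smul_apply,
      coeff_youngSymmetrizer_one, smul_eq_mul, mul_one, sub_self]

/-- The scalar `h` with `c * c = h • c` for the Young symmetrizer `c`. -/
noncomputable def hookScalar {n : ℕ} (l : n.Partition) : ℂ :=
  (youngSymmetrizer l * youngSymmetrizer l).coeff 1

theorem youngSymmetrizer_mul_self {n : ℕ} (l : n.Partition) :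
    youngSymmetrizer l * youngSymmetrizer l = hookScalar l • youngSymmetrizer l := by
  have h := youngSymmetrizer_mul_mul l 1
  rwa [mul_one] at h

/-! ### Characters -/

/-- In the basis of group elements, the diagonal entry at `h` is the coefficient of `h` in `g * h *
e`. -/
theorem trace_single_mul_mul {G : Type*} [Group G] [Fintype G] (g : G) (e : MonoidAlgebra ℂ G) :
    LinearMap.trace ℂ (MonoidAlgebra ℂ G)
      (LinearMap.mulRight ℂ e ∘ₗ LinearMap.mulLeft ℂ (MonoidAlgebra.single g 1)) =
      ∑ h : G, e.coeff (h⁻¹ * g⁻¹ * h) := by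
  classical
  let b : Module.Basis G ℂ (MonoidAlgebra ℂ G) := .ofRepr (MonoidAlgebra.coeffLinearEquiv ℂ)
  have hb : ∀ h, b h = MonoidAlgebra.single h 1 := fun h => by
    apply b.repr.injective
    rw [b.repr_self]
    rfl
  rw [LinearMap.trace_eq_matrix_trace ℂ b, Matrix.trace]
  refine Finset.sum_congr rfl fun h _ => ?_
  rw [Matrix.diag_apply, LinearMap.toMatrix_apply, hb]
  change (MonoidAlgebra.single g 1 * MonoidAlgebra.single h 1 * e).coeff h = _
  rw [MonoidAlgebra.single_mul_single, one_mul, MonoidAlgebra.coeff_single_mul_apply, one_mul]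
  congr 1
  group

/-- Otherwise right multiplication by the symmetrizer would square to zero and have trace zero,
whereas its trace is the group order times the coefficient one at the identity. -/
theorem hookScalar_ne_zero {n : ℕ} (l : n.Partition) : hookScalar l ≠ 0 := by
  intro h
  have h1 := trace_single_mul_mul (1 : Equiv.Perm (Fin n)) (youngSymmetrizer l)
  have h2 : IsNilpotent (LinearMap.mulRight ℂ (youngSymmetrizer l) ∘ₗ
      LinearMap.mulLeft ℂ (MonoidAlgebra.single (1 : Equiv.Perm (Fin n)) (1 : ℂ))) := by
    refine ⟨2, ?_⟩
    ext1
    refine LinearMap.ext fun x => ?_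
    simp [pow_two, ← MonoidAlgebra.one_def, mul_assoc, youngSymmetrizer_mul_self, h]
  have h3 := (LinearMap.isNilpotent_trace_of_isNilpotent h2).eq_zero
  rw [h1] at h3
  simp [coeff_youngSymmetrizer_one] at h3

/-- Right multiplication by the normalized symmetrizer projects the group algebra onto the Specht
module, so the trace of `g` there is the trace of `x ↦ g * x * e` on the whole algebra. -/
theorem permCharacter_eq {n : ℕ} (l : n.Partition) (g : Equiv.Perm (Fin n)) :
    permCharacter l g =
      (hookScalar l)⁻¹ * ∑ h, (youngSymmetrizer l).coeff (h⁻¹ * g⁻¹ * h) := by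
  have h0 := hookScalar_ne_zero l
  set e := (hookScalar l)⁻¹ • youngSymmetrizer l with he
  set p := (spechtModule l).restrictScalars ℂ with hp
  have h1 := trace_single_mul_mul g e
  have hmem : ∀ x, (LinearMap.mulRight ℂ e ∘ₗ
      LinearMap.mulLeft ℂ (MonoidAlgebra.single g (1 : ℂ))) x ∈ p := by
    intro x
    change MonoidAlgebra.single g 1 * x * e ∈ spechtModule l
    rw [he, mul_smul_comm]
    exact (spechtModule l).smul_of_tower_mem _
      (Ideal.mul_mem_left _ _ (Ideal.subset_span rfl))
  have h2 := LinearMap.trace_restrict_eq_of_forall_mem p _ hmem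
  rw [h1] at h2
  have h3 : permCharacter l g = LinearMap.trace ℂ p (LinearMap.restrict _ fun x _ => hmem x) := by
    refine congrArg (LinearMap.trace ℂ p) (LinearMap.ext fun x => Subtype.ext ?_)
    have hx : x.1 ∈ spechtModule l := x.2
    obtain ⟨a, ha⟩ := Ideal.mem_span_singleton'.mp hx
    change MonoidAlgebra.single g (1 : ℂ) * x.1 = MonoidAlgebra.single g 1 * x.1 * e
    rw [← ha, he, mul_smul_comm, mul_assoc, mul_assoc, youngSymmetrizer_mul_self,
      mul_smul_comm, mul_smul_comm, smul_smul, inv_mul_cancel₀ h0, one_smul]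
  rw [h3, h2, he, Finset.mul_sum]
  simp

theorem permCharacter_conj {n : ℕ} (l : n.Partition) (g a : Equiv.Perm (Fin n)) :
    permCharacter l (a * g * a⁻¹) = permCharacter l g :=
  Representation.char_conj _ _ _

theorem partition_inv {n : ℕ} (g : Equiv.Perm (Fin n)) :
    g⁻¹.partition.parts = g.partition.parts := by
  simp [Equiv.Perm.parts_partition]

theorem isConj_of_parts_eq {n : ℕ} {g h : Equiv.Perm (Fin n)}
    (hgh : g.partition.parts = h.partition.parts) : IsConj g h :=
  Equiv.Perm.partition_eq_of_isConj.mpr (Nat.Partition.ext hgh)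

/-- Pairing a class function with a character. -/
theorem sum_mul_permCharacter {n : ℕ} (l : n.Partition) (ψ : Equiv.Perm (Fin n) → ℂ)
    (hψ : ∀ g a, ψ (a * g * a⁻¹) = ψ g) :
    ∑ g, ψ g * permCharacter l g⁻¹ =
      (n.factorial : ℂ) * (hookScalar l)⁻¹ * ∑ g, (youngSymmetrizer l).coeff g * ψ g := by
  simp_rw [permCharacter_eq, Finset.mul_sum]
  rw [Finset.sum_comm]
  have h : ∀ h : Equiv.Perm (Fin n), ∑ g, ψ g * ((hookScalar l)⁻¹ *
      (youngSymmetrizer l).coeff (h⁻¹ * g⁻¹⁻¹ * h)) =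
      ∑ g, (hookScalar l)⁻¹ * ((youngSymmetrizer l).coeff g * ψ g) := by
    intro h
    refine Fintype.sum_equiv (MulAut.conj h⁻¹).toEquiv _ _ fun g => ?_
    have h1 : ψ (h⁻¹ * g * h) = ψ g := by simpa using hψ g h⁻¹
    simp only [MulEquiv.toEquiv_eq_coe, MulEquiv.coe_toEquiv, MulAut.conj_apply, inv_inv, h1]
    ring
  simp_rw [h, Finset.sum_const, Finset.card_univ, Fintype.card_perm, Fintype.card_fin, nsmul_eq_mul,
    Finset.mul_sum, mul_assoc]

/-- This turns a pairing of conjugated coefficients into one coefficient of a product, to which the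
multiplication rules for symmetrizers apply. -/
theorem sum_coeff_mul_coeff {n : ℕ} (x y : MonoidAlgebra ℂ (Equiv.Perm (Fin n)))
    (h : Equiv.Perm (Fin n)) :
    (x * MonoidAlgebra.single h 1 * y * MonoidAlgebra.single h⁻¹ 1).coeff 1 =
      ∑ g, x.coeff g * y.coeff (h⁻¹ * g⁻¹ * h) := by
  rw [mul_assoc, mul_assoc, MonoidAlgebra.coeff_mul_apply_left, Finsupp.sum_fintype _ _ (by simp)]
  refine Finset.sum_congr rfl fun g _ => ?_
  rw [MonoidAlgebra.coeff_single_mul_apply, MonoidAlgebra.coeff_mul_single_apply]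
  simp [mul_assoc]

theorem sum_permCharacter_mul {n : ℕ} (l m : n.Partition) :
    ∑ g, permCharacter m g * permCharacter l g⁻¹ =
      (n.factorial : ℂ) * (hookScalar l)⁻¹ * ((hookScalar m)⁻¹ * ∑ h,
        (youngSymmetrizer l * MonoidAlgebra.single h 1 * youngSymmetrizer m *
          MonoidAlgebra.single h⁻¹ 1).coeff 1) := by
  rw [sum_mul_permCharacter l _ (permCharacter_conj m)]
  congr 1
  simp_rw [permCharacter_eq, sum_coeff_mul_coeff, Finset.mul_sum]
  rw [Finset.sum_comm]
  refine Finset.sum_congr rfl fun h _ => Finset.sum_congr rfl fun g _ => ?_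
  ring

/-- The annihilation of symmetrizers needs `rowSum l ≤ rowSum m`. The sum is symmetric in `l` and
`m` under `g ↦ g⁻¹`, so this may be assumed. -/
theorem sum_permCharacter_mul_eq_zero {n : ℕ} {l m : n.Partition} (hne : l ≠ m) :
    ∑ g, permCharacter m g * permCharacter l g⁻¹ = 0 := by
  have key : ∀ l m : n.Partition, l ≠ m → rowSum l ≤ rowSum m →
      ∑ g, permCharacter m g * permCharacter l g⁻¹ = 0 := by
    intro l m hne hle
    rw [sum_permCharacter_mul, Finset.sum_eq_zero, mul_zero, mul_zero]
    intro h _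
    have h1 := rowSymmetrizer_mul_mul_colAntisymmetrizer hne hle
      (colAntisymmetrizer l * MonoidAlgebra.single h 1 * rowSymmetrizer m)
    have h2 : youngSymmetrizer l * MonoidAlgebra.single h 1 * youngSymmetrizer m = 0 := by
      rw [← h1, youngSymmetrizer_eq, youngSymmetrizer_eq]
      simp only [mul_assoc]
    rw [h2, zero_mul]
    rfl
  rcases le_total (rowSum l) (rowSum m) with hle | hle
  · exact key l m hne hle
  · rw [← key m l hne.symm hle]
    refine Fintype.sum_equiv (Equiv.inv _) _ _ fun g => ?_
    simp [mul_comm]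

theorem sum_permCharacter_mul_self {n : ℕ} (l : n.Partition) :
    ∑ g, permCharacter l g * permCharacter l g⁻¹ = n.factorial := by
  have h0 := hookScalar_ne_zero l
  set c := youngSymmetrizer l with hc
  rw [sum_permCharacter_mul]
  -- By the sandwich property `c * h * c` is a multiple of `c`, and `c * h⁻¹` has coefficient
  -- `c.coeff h` at the identity. The sum therefore reassembles `c * c * c`, whose coefficient at
  -- the identity is `hookScalar l ^ 2`.
  have h1 : ∑ h, (c * MonoidAlgebra.single h 1 * c * MonoidAlgebra.single h⁻¹ 1).coeff 1 =
      (c * c * c).coeff 1 := by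
    have h2 : c * c * c = ∑ h, c.coeff h • (c * MonoidAlgebra.single h 1 * c) := by
      conv_lhs =>
        enter [1, 2]
        rw [← MonoidAlgebra.sum_coeff_single c, Finsupp.sum_fintype _ _ (by simp)]
      rw [Finset.mul_sum, Finset.sum_mul]
      refine Finset.sum_congr rfl fun h _ => ?_
      rw [← smul_mul_assoc, ← mul_smul_comm, MonoidAlgebra.smul_single, smul_eq_mul, mul_one]
    rw [h2, MonoidAlgebra.coeff_sum, Finset.sum_apply']
    refine Finset.sum_congr rfl fun h _ => ?_
    rw [hc, youngSymmetrizer_mul_mul, ← hc, smul_mul_assoc, MonoidAlgebra.coeff_smul_apply,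
      MonoidAlgebra.coeff_mul_single_apply, MonoidAlgebra.coeff_smul_apply,
      MonoidAlgebra.coeff_smul_apply, hc, coeff_youngSymmetrizer_one]
    simp [mul_comm]
  rw [h1, hc, youngSymmetrizer_mul_self, smul_mul_assoc, youngSymmetrizer_mul_self, smul_smul,
    MonoidAlgebra.coeff_smul_apply, coeff_youngSymmetrizer_one]
  simp
  field_simp

/-- The expansion of a class function in irreducible characters. -/
theorem classFunction_eq_sum {n : ℕ} (ψ : Equiv.Perm (Fin n) → ℂ)
    (hψ : ∀ g a, ψ (a * g * a⁻¹) = ψ g) (g : Equiv.Perm (Fin n)) :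
    ψ g = ∑ l : n.Partition,
      ((hookScalar l)⁻¹ * ∑ h, (youngSymmetrizer l).coeff h * ψ h) * permCharacter l g := by
  classical
  have hn : (n.factorial : ℂ) ≠ 0 := Nat.cast_ne_zero.mpr (Nat.factorial_ne_zero n)
  let r : n.Partition → Equiv.Perm (Fin n) := fun t => (exists_perm_of_type t).choose
  have hr : ∀ t, (r t).partition.parts = t.parts := fun t => (exists_perm_of_type t).choose_spec
  let type : Equiv.Perm (Fin n) → n.Partition := fun g =>
    ⟨g.partition.parts, g.partition.parts_pos, g.partition.parts_sum.trans (Fintype.card_fin n)⟩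
  have hclass : ∀ φ : Equiv.Perm (Fin n) → ℂ, (∀ g a, φ (a * g * a⁻¹) = φ g) →
      ∀ g h, g.partition.parts = h.partition.parts → φ g = φ h := by
    intro φ hφ g h hgh
    obtain ⟨a, ha⟩ := isConj_iff.mp (isConj_of_parts_eq hgh)
    rw [← ha, hφ]
  have htype : ∀ φ : Equiv.Perm (Fin n) → ℂ, (∀ g a, φ (a * g * a⁻¹) = φ g) →
      ∀ g, φ g = φ (r (type g)) := fun φ hφ g => hclass φ hφ _ _ (hr (type g)).symm
  have hsum : ∀ φ : Equiv.Perm (Fin n) → ℂ, (∀ g a, φ (a * g * a⁻¹) = φ g) →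
      ∑ g, φ g = ∑ t, ((Finset.univ.filter fun g => type g = t).card : ℂ) * φ (r t) := by
    intro φ hφ
    rw [← Finset.sum_fiberwise_of_maps_to (s := Finset.univ) (t := Finset.univ) (g := type)
      (by simp)]
    refine Finset.sum_congr rfl fun t _ => ?_
    rw [← nsmul_eq_mul, ← Finset.sum_const]
    refine Finset.sum_congr rfl fun g hg => ?_
    rw [htype φ hφ g, (Finset.mem_filter.mp hg).2]
  have hinv : ∀ φ : Equiv.Perm (Fin n) → ℂ, (∀ g a, φ (a * g * a⁻¹) = φ g) →
      ∀ g, φ g⁻¹ = φ g := fun φ hφ g => hclass φ hφ _ _ (partition_inv g)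
  let B : Matrix n.Partition n.Partition ℂ := Matrix.of fun l t => permCharacter l (r t)
  let D : Matrix n.Partition n.Partition ℂ := Matrix.of fun t l =>
    ((Finset.univ.filter fun g => type g = t).card : ℂ) * permCharacter l (r t) *
      (n.factorial : ℂ)⁻¹
  have hBD : B * D = 1 := by
    ext l m
    have h1 : (B * D) l m =
        (n.factorial : ℂ)⁻¹ * ∑ g, permCharacter l g * permCharacter m g⁻¹ := by
      simp_rw [hinv _ (permCharacter_conj m)]
      rw [hsum (fun g => permCharacter l g * permCharacter m g) (fun g a => by
        simp only [permCharacter_conj]), Matrix.mul_apply, Finset.mul_sum]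
      refine Finset.sum_congr rfl fun t _ => ?_
      simp only [B, D, Matrix.of_apply]
      ring
    rw [h1, Matrix.one_apply]
    split_ifs with hlm
    · rw [hlm, sum_permCharacter_mul_self, inv_mul_cancel₀ hn]
    · rw [sum_permCharacter_mul_eq_zero (Ne.symm hlm), mul_zero]
  -- Both indices run over partitions of `n`, so the character table is square and row orthogonality
  -- implies completeness.
  have hDB : D * B = 1 := mul_eq_one_comm.mp hBD
  have hcoef : ∀ l, (hookScalar l)⁻¹ * ∑ h, (youngSymmetrizer l).coeff h * ψ h =
      ∑ t, ψ (r t) * D t l := by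
    intro l
    have h1 := sum_mul_permCharacter l ψ hψ
    simp_rw [hinv _ (permCharacter_conj l)] at h1
    rw [hsum (fun g => ψ g * permCharacter l g) (fun g a => by
        simp only [permCharacter_conj, hψ])] at h1
    have h2 : ∑ t, ψ (r t) * D t l = (n.factorial : ℂ)⁻¹ *
        ∑ t, ((Finset.univ.filter fun g => type g = t).card : ℂ) *
          (ψ (r t) * permCharacter l (r t)) := by
      rw [Finset.mul_sum]
      refine Finset.sum_congr rfl fun t _ => ?_
      simp only [D, Matrix.of_apply]
      ring
    rw [h2, h1, mul_assoc, inv_mul_cancel_left₀ hn]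
  rw [htype ψ hψ g]
  calc ψ (r (type g)) = ∑ t, ψ (r t) * (1 : Matrix n.Partition n.Partition ℂ) t (type g) := by
        simp [Matrix.one_apply]
    _ = ∑ t, ψ (r t) * ∑ l, D t l * B l (type g) := by
        rw [← hDB]
        rfl
    _ = _ := by
        simp_rw [hcoef, Finset.sum_mul, Finset.mul_sum]
        rw [Finset.sum_comm]
        refine Finset.sum_congr rfl fun l _ => Finset.sum_congr rfl fun t _ => ?_
        rw [htype _ (permCharacter_conj l) g, mul_assoc]
        rfl

/-! ### Rearrangement within classes -/

/-- Adding a large multiple of `κ` to both functions makes them vary together globally, so the usual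
rearrangement inequality applies. The added cross terms do not change under a class-preserving
permutation. -/
theorem sum_mul_comp_perm_le_of_classes {α : Type*} [Fintype α] (κ f g : α → ℕ)
    (p : Equiv.Perm α) (hp : ∀ i, κ (p i) = κ i)
    (hfg : ∀ i j, κ i = κ j → g i < g j → f i ≤ f j) :
    ∑ i, f i * g (p i) ≤ ∑ i, f i * g i ∧
      (∑ i, f i * g (p i) = ∑ i, f i * g i →
        ∀ i j, κ i = κ j → g (p i) < g (p j) → f i ≤ f j) := by
  set B := ∑ i, f i + ∑ i, g i with hB
  have hf : ∀ i, f i ≤ B := fun i =>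
    (Finset.single_le_sum (fun _ _ => Nat.zero_le _) (Finset.mem_univ i)).trans
      (Nat.le_add_right _ _)
  have hg : ∀ i, g i ≤ B := fun i =>
    (Finset.single_le_sum (fun _ _ => Nat.zero_le _) (Finset.mem_univ i)).trans
      (Nat.le_add_left _ _)
  have hmul : ∀ {a b : ℕ}, a < b → B + B * a ≤ B * b := fun {a b} h => by
    calc B + B * a = B * (a + 1) := by ring
      _ ≤ B * b := Nat.mul_le_mul_left _ h
  have hmono : Monovary (fun i => f i + B * κ i) (fun i => g i + B * κ i) := by
    intro i j hij
    simp only at hij ⊢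
    rcases lt_trichotomy (κ i) (κ j) with h | h | h
    · have := hmul h; have := hf i; omega
    · have := hfg i j h (by rw [h] at hij; omega)
      rw [h]; omega
    · have := hmul h; have := hg j; omega
  have hexp : ∀ s : Equiv.Perm α, (∀ i, κ (s i) = κ i) →
      ∑ i, (f i + B * κ i) * (g (s i) + B * κ (s i)) =
        ∑ i, f i * g (s i) + (B * ∑ i, κ i * g i + B * ∑ i, f i * κ i +
          B * B * ∑ i, κ i * κ i) := by
    intro s hs
    have h1 : ∑ i, κ i * g i = ∑ i, κ i * g (s i) := by
      rw [← Equiv.sum_comp s]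
      simp_rw [hs]
    rw [h1, Finset.mul_sum, Finset.mul_sum, Finset.mul_sum, ← Finset.sum_add_distrib,
      ← Finset.sum_add_distrib, ← Finset.sum_add_distrib]
    refine Finset.sum_congr rfl fun i _ => ?_
    rw [hs]
    ring
  have h1 := hexp p hp
  have h2 := hexp 1 (fun _ => rfl)
  simp only [Equiv.Perm.one_apply] at h2
  refine ⟨?_, fun heq => ?_⟩
  · have h3 := hmono.sum_mul_comp_perm_le_sum_mul (σ := p)
    rw [h1, h2] at h3
    omega
  · have h3 := (hmono.sum_mul_comp_perm_eq_sum_mul_iff (σ := p)).mp (by rw [h1, h2, heq])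
    intro i j hij hlt
    have h4 := h3 (i := i) (j := j) (by
      simp only [Function.comp_apply, hp, hij]
      omega)
    simp only [hij] at h4
    omega

/-- Rearrangement with `f = g ∘ p` bounds the sum of the squares of `g ∘ p` by its pairing with `g`,
which makes the squared distance from `g ∘ p` to `g` nonpositive. -/
theorem comp_perm_eq_of_monotone_classes {α : Type*} [Fintype α] (κ o g : α → ℕ)
    (p : Equiv.Perm α) (hp : ∀ i, κ (p i) = κ i)
    (hg : ∀ i j, κ i = κ j → o i ≤ o j → g i ≤ g j)
    (hgp : ∀ i j, κ i = κ j → o i ≤ o j → g (p i) ≤ g (p j)) (i : α) : g (p i) = g i := by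
  have h1 := (sum_mul_comp_perm_le_of_classes κ (fun i => g (p i)) g p hp (by
    intro i j hij hlt
    refine hgp i j hij ?_
    by_contra hcon
    exact absurd (hg j i hij.symm (by omega)) (by omega))).1
  have h2 : ∑ i, (((g (p i) : ℤ) - g i) ^ 2) =
      2 * (((∑ i, g (p i) * g (p i) : ℕ) : ℤ) - ((∑ i, g (p i) * g i : ℕ) : ℤ)) := by
    have h3 : ∑ i, g (p i) * g (p i) = ∑ i, g i * g i := Equiv.sum_comp p fun i => g i * g i
    have h4 : ∀ i, ((g (p i) : ℤ) - g i) ^ 2 =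
        (g (p i) * g (p i) : ℕ) + (g i * g i : ℕ) - 2 * (g (p i) * g i : ℕ) := fun i => by
      push_cast; ring
    simp_rw [h4, Finset.sum_sub_distrib, Finset.sum_add_distrib, ← Finset.mul_sum, ← Nat.cast_sum,
      h3]
    ring
  have h5 : ∑ i, (((g (p i) : ℤ) - g i) ^ 2) = 0 := by
    refine le_antisymm ?_ (Finset.sum_nonneg fun i _ => sq_nonneg _)
    rw [h2]
    have : ((∑ i, g (p i) * g (p i) : ℕ) : ℤ) ≤ ((∑ i, g (p i) * g i : ℕ) : ℤ) :=
      Int.ofNat_le.mpr h1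
    linarith
  rw [Finset.sum_eq_zero_iff_of_nonneg fun i _ => sq_nonneg _] at h5
  have h6 := pow_eq_zero_iff (two_ne_zero) |>.mp (h5 i (Finset.mem_univ i))
  omega

/-! ### Semistandard fillings and ranks -/

/-- A filling of the boxes, given by the values at the numbered boxes, is semistandard if it
increases weakly along rows and strictly along columns. -/
structure IsSemistandard {n : ℕ} (l : n.Partition) (a : Fin n → ℕ) : Prop where
  row_le : ∀ i j, rowOf l i = rowOf l j → colOf l i ≤ colOf l j → a i ≤ a j
  col_lt : ∀ i j, colOf l i = colOf l j → rowOf l i < rowOf l j → a i < a j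

theorem IsSemistandard.col_le {n : ℕ} {l : n.Partition} {a : Fin n → ℕ} (ha : IsSemistandard l a)
    (i j : Fin n) (hc : colOf l i = colOf l j) (hr : rowOf l i ≤ rowOf l j) : a i ≤ a j := by
  rcases hr.eq_or_lt with h | h
  · rw [box_injective l h hc]
  · exact (ha.col_lt i j hc h).le

/-- The entries of a filling weighted by column indices. -/
noncomputable def colWeight {n : ℕ} (l : n.Partition) (a : Fin n → ℕ) : ℕ := ∑ i, colOf l i * a i

/-- This is the triangularity of the symmetrizer on semistandard fillings. Column moves keep the
column weight, and row moves cannot raise it when entries increase along rows. In the equality case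
monotonicity along rows, then along columns, forces both moves to fix the fillings. -/
theorem IsSemistandard.colWeight_le {n : ℕ} {l : n.Partition} {a b : Fin n → ℕ}
    (ha : IsSemistandard l a) (hb : IsSemistandard l b) {p q : Equiv.Perm (Fin n)}
    (hp : p ∈ rowGroup l) (hq : q ∈ colGroup l) (hab : ∀ i, b (q i) = a (p i)) :
    colWeight l b ≤ colWeight l a ∧
      (colWeight l b = colWeight l a → (∀ i, b (q i) = b i) ∧ b = a) := by
  rw [mem_rowGroup] at hp
  rw [mem_colGroup] at hq
  have h1 : colWeight l b = ∑ i, colOf l i * a (p i) := by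
    rw [colWeight, ← Equiv.sum_comp q]
    simp_rw [hq, hab]
  obtain ⟨h2, h3⟩ := sum_mul_comp_perm_le_of_classes (rowOf l) (colOf l) a p hp (by
    intro i j hij hlt
    by_contra hcon
    exact absurd (ha.row_le j i hij.symm (by omega)) (by omega))
  refine ⟨h1.trans_le h2, fun heq => ?_⟩
  have h4 : ∀ i, a (p i) = a i := by
    refine comp_perm_eq_of_monotone_classes (rowOf l) (colOf l) a p hp ha.row_le ?_
    intro i j hij hc
    rcases hc.eq_or_lt with h | h
    · rw [box_injective l hij h]
    · by_contra hcon
      exact absurd (h3 (h1.symm.trans heq) j i hij.symm (by omega)) (by omega)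
  have h5 : ∀ i, b (q i) = b i := by
    refine comp_perm_eq_of_monotone_classes (colOf l) (rowOf l) b q hq hb.col_le ?_
    intro i j hij hr
    rw [hab, hab, h4, h4]
    exact ha.col_le i j hij hr
  exact ⟨h5, funext fun i => by rw [← h5, hab, h4]⟩

theorem IsSemistandard.eq_one {n : ℕ} {l : n.Partition} {a : Fin n → ℕ}
    (ha : IsSemistandard l a) {q : Equiv.Perm (Fin n)} (hq : q ∈ colGroup l)
    (h : ∀ i, a (q i) = a i) : q = 1 := by
  rw [mem_colGroup] at hq
  ext1 i
  refine box_injective l ?_ (hq i)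
  rcases lt_trichotomy (rowOf l (q i)) (rowOf l i) with hlt | heq | hlt
  · exact absurd (ha.col_lt _ _ (hq i) hlt) (by rw [h]; omega)
  · exact heq
  · exact absurd (ha.col_lt _ _ (hq i).symm hlt) (by rw [h]; omega)

/-- The matrices of a permutation action. -/
noncomputable def actionMatrix {G X : Type*} [Group G] [Fintype X] [DecidableEq X]
    (ρ : G →* Equiv.Perm X) : MonoidAlgebra ℂ G →ₐ[ℂ] Matrix X X ℂ :=
  MonoidAlgebra.lift ℂ (Matrix X X ℂ) G
    { toFun := fun g => Matrix.of fun s t => if ρ g t = s then 1 else 0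
      map_one' := by
        ext s t
        simp [Matrix.one_apply, eq_comm]
      map_mul' := by
        intro g h
        ext s t
        simp [Matrix.mul_apply] }

theorem actionMatrix_single {G X : Type*} [Group G] [Fintype X] [DecidableEq X]
    (ρ : G →* Equiv.Perm X) (g : G) (r : ℂ) (s t : X) :
    actionMatrix ρ (MonoidAlgebra.single g r) s t = r * if ρ g t = s then 1 else 0 := by
  rw [actionMatrix, MonoidAlgebra.lift_single]
  rfl

theorem trace_actionMatrix {G X : Type*} [Group G] [Fintype G] [Fintype X] [DecidableEq X]
    (ρ : G →* Equiv.Perm X) (x : MonoidAlgebra ℂ G) :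
    (actionMatrix ρ x).trace =
      ∑ g, x.coeff g * ((Finset.univ.filter fun t => ρ g t = t).card : ℂ) := by
  conv_lhs => rw [← MonoidAlgebra.sum_coeff_single x, Finsupp.sum_fintype _ _ (by simp)]
  rw [map_sum, Matrix.trace_sum]
  refine Finset.sum_congr rfl fun g _ => ?_
  simp_rw [Matrix.trace, Matrix.diag_apply, actionMatrix_single]
  rw [← Finset.mul_sum, Finset.card_filter]
  push_cast
  rfl

theorem trace_eq_rank_of_isIdempotentElem {X : Type*} [Fintype X] [DecidableEq X]
    {E : Matrix X X ℂ} (hE : IsIdempotentElem E) : E.trace = E.rank := by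
  have h1 : IsIdempotentElem (Matrix.toLin' E) := by
    rw [IsIdempotentElem, Module.End.mul_eq_comp, ← Matrix.toLin'_mul, hE.eq]
  rw [← Matrix.trace_toLin'_eq, (LinearMap.IsIdempotentElem.isProj_range _ h1).trace, Matrix.rank]
  rfl

/-- The trace of the idempotent attached to a shape, in a permutation representation on fillings,
is a natural number that is at least the number of semistandard fillings. -/
theorem exists_multiplicity {n : ℕ} (l : n.Partition) {X : Type*} [Fintype X] [DecidableEq X]
    (ρ : Equiv.Perm (Fin n) →* Equiv.Perm X) (v : X → Fin n → ℕ) (hv : Function.Injective v)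
    (hρ : ∀ g x i, v (ρ g x) i = v x (g⁻¹ i)) (S : Finset X)
    (hS : ∀ x ∈ S, IsSemistandard l (v x)) :
    ∃ N : ℕ, S.card ≤ N ∧ (hookScalar l)⁻¹ * ∑ g, (youngSymmetrizer l).coeff g *
      ((Finset.univ.filter fun t => ρ g t = t).card : ℂ) = N := by
  have h0 := hookScalar_ne_zero l
  set M := actionMatrix ρ (youngSymmetrizer l) with hM
  have hid : IsIdempotentElem ((hookScalar l)⁻¹ • M) := by
    rw [IsIdempotentElem, smul_mul_assoc, mul_smul_comm, hM, ← map_mul, youngSymmetrizer_mul_self,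
      map_smul, smul_smul _ (hookScalar l), inv_mul_cancel₀ h0, one_smul]
  have htr := trace_eq_rank_of_isIdempotentElem hid
  rw [Matrix.trace_smul, hM, trace_actionMatrix, ← hM, smul_eq_mul] at htr
  refine ⟨_, ?_, htr⟩
  have hentry : ∀ t s, M t s = ∑ p ∈ rowGroup l, ∑ q ∈ colGroup l,
      ((Equiv.Perm.sign q : ℤ) : ℂ) * if ρ (p * q) s = t then 1 else 0 := by
    intro t s
    rw [hM, youngSymmetrizer, Finset.sum_mul_sum, map_sum, Matrix.sum_apply]
    refine Finset.sum_congr rfl fun p _ => ?_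
    rw [map_sum, Matrix.sum_apply]
    refine Finset.sum_congr rfl fun q _ => ?_
    rw [MonoidAlgebra.single_mul_single, one_mul, actionMatrix_single]
  have hrel : ∀ s t p q, ρ (p * q) s = t → ∀ i, v s (q⁻¹ i) = v t (p i) := by
    intro s t p q h i
    rw [← h, map_mul, Equiv.Perm.mul_apply, hρ, hρ]
    simp
  -- On `S`, ordered by column weight, the matrix is triangular.
  have hzero : ∀ s ∈ S, ∀ t ∈ S, M t s ≠ 0 → colWeight l (v s) ≤ colWeight l (v t) ∧
      (colWeight l (v s) = colWeight l (v t) → s = t) := by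
    intro s hs t ht hne
    rw [hentry] at hne
    obtain ⟨p, hp, hne⟩ := Finset.exists_ne_zero_of_sum_ne_zero hne
    obtain ⟨q, hq, hne⟩ := Finset.exists_ne_zero_of_sum_ne_zero hne
    have h1 : ρ (p * q) s = t := by
      by_contra h
      rw [if_neg h, mul_zero] at hne
      exact hne rfl
    obtain ⟨h2, h3⟩ := (hS t ht).colWeight_le (hS s hs) hp (inv_mem_colGroup hq)
      (hrel s t p q h1)
    exact ⟨h2, fun h => hv (h3 h).2⟩
  -- Only `q = 1` contributes on the diagonal, so no signs cancel and the entry counts the row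
  -- permutations fixing `t`.
  have hdiag : ∀ t ∈ S, M t t ≠ 0 := by
    intro t ht
    have h1 : M t t = ((rowGroup l).filter fun p => ρ p t = t).card := by
      rw [hentry, Finset.card_filter, Nat.cast_sum]
      refine Finset.sum_congr rfl fun p hp => ?_
      rw [Finset.sum_eq_single 1]
      · simp
      · intro q hq hq1
        rw [if_neg, mul_zero]
        intro h
        have h2 := (((hS t ht).colWeight_le (hS t ht) hp (inv_mem_colGroup hq)
          (hrel t t p q h)).2 rfl).1
        exact hq1 (inv_eq_one.mp ((hS t ht).eq_one (inv_mem_colGroup hq) h2))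
      · exact fun h => absurd (one_mem_colGroup l) h
    rw [h1, Nat.cast_ne_zero]
    exact (Finset.card_pos.mpr ⟨1, by simp [one_mem_rowGroup]⟩).ne'
  have hind : LinearIndependent ℂ fun s : S => ((hookScalar l)⁻¹ • M).col s := by
    rw [Fintype.linearIndependent_iff]
    intro w hw
    by_contra! hcon
    -- For a relation among the columns, take `t` of least column weight in its support; in row `t`
    -- only the diagonal term survives.
    obtain ⟨t, ht, hmin⟩ := (Finset.univ.filter fun s : S => w s ≠ 0).exists_min_image
      (fun s => colWeight l (v s)) (by
        obtain ⟨t, ht⟩ := hcon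
        exact ⟨t, by simpa using ht⟩)
    simp only [Finset.mem_filter, Finset.mem_univ, true_and] at ht hmin
    have h1 := congrFun hw t.1
    rw [Finset.sum_apply, Finset.sum_eq_single t] at h1
    · simp [ht, h0, hdiag t.1 t.2] at h1
    · intro s _ hst
      by_cases hws : w s = 0
      · simp [hws]
      · have h2 : M t.1 s.1 = 0 := by
          by_contra hne
          obtain ⟨h3, h4⟩ := hzero s.1 s.2 t.1 t.2 hne
          exact hst (Subtype.ext (h4 (le_antisymm h3 (hmin s hws))))
        simp [h2]
    · simp
  rw [Matrix.rank_eq_finrank_span_cols]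
  calc S.card = Module.finrank ℂ (Submodule.span ℂ
        (Set.range fun s : S => ((hookScalar l)⁻¹ • M).col s)) := by
        rw [finrank_span_eq_card hind, Fintype.card_coe]
    _ ≤ _ := Submodule.finrank_mono (Submodule.span_mono (by
        rintro _ ⟨s, rfl⟩
        exact ⟨s.1, rfl⟩))

/-! ### Values of quotients of alternants at one -/

/-- The value at `(1, …, 1)` of the quotient of the alternant of `a` by the Vandermonde
determinant. -/
noncomputable def schurValue (k : ℕ) (a : ℕ → ℕ) : ℤ :=
  MvPolynomial.eval (fun _ => 1) (alternant_zero_dvd k a).choose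

theorem schurAtOne_eq {n : ℕ} {k : ℕ} {l : n.Partition} (h : length l ≤ k) :
    schurAtOne k l = schurValue k (part l) := by
  rw [schurAtOne, schurPoly, if_pos h, schurValue]

theorem schurAtOne_eq_zero {n : ℕ} {k : ℕ} {l : n.Partition} (h : ¬ length l ≤ k) :
    schurAtOne k l = 0 := by
  rw [schurAtOne, schurPoly, if_neg h, map_zero]

/-- The exponents of the alternant. -/
def shifted (k : ℕ) (a : ℕ → ℕ) (j : ℕ) : ℕ := a j + (k - 1 - j)

/-- With `x_i = X ^ i` the entries become `(X ^ shifted k a j) ^ i`, a transposed Vandermonde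
matrix. Setting all variables to one directly would give `0 / 0`. -/
theorem aeval_alternant (k : ℕ) (a : ℕ → ℕ) :
    MvPolynomial.aeval (fun i : Fin k => (X : ℤ[X]) ^ (i : ℕ)) (alternant k a) =
      ∏ i : Fin k, ∏ j ∈ Finset.Ioi i, (X ^ shifted k a j - X ^ shifted k a i) := by
  rw [← Matrix.det_vandermonde (fun j : Fin k => (X : ℤ[X]) ^ shifted k a j),
    ← Matrix.det_transpose, alternant, AlgHom.map_det]
  congr 1
  ext1 i j
  simp only [AlgHom.mapMatrix_apply, Matrix.map_apply, Matrix.of_apply, map_pow,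
    MvPolynomial.aeval_X, Matrix.transpose_apply, Matrix.vandermonde_apply]
  rw [← pow_mul, ← pow_mul, mul_comm, shifted]

theorem prod_shifted_zero_ne_zero (k : ℕ) :
    ∏ i : Fin k, ∏ j ∈ Finset.Ioi i,
      ((shifted k (fun _ => 0) j : ℤ) - shifted k (fun _ => 0) i) ≠ 0 := by
  rw [Finset.prod_ne_zero_iff]
  intro i _
  rw [Finset.prod_ne_zero_iff]
  intro j hj
  rw [Finset.mem_Ioi, Fin.lt_def] at hj
  simp only [shifted]
  omega

theorem alternant_zero_ne_zero (k : ℕ) : alternant k (fun _ => 0) ≠ 0 := by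
  intro h
  have h1 := aeval_alternant k (fun _ => 0)
  rw [h, map_zero, eq_comm, Finset.prod_eq_zero_iff] at h1
  obtain ⟨i, _, h1⟩ := h1
  rw [Finset.prod_eq_zero_iff] at h1
  obtain ⟨j, hj, h1⟩ := h1
  rw [Finset.mem_Ioi, Fin.lt_def] at hj
  have h2 := congrArg (eval 2) h1
  simp only [eval_sub, eval_pow, eval_X, eval_zero, sub_eq_zero] at h2
  have h3 := pow_right_injective₀ (a := (2 : ℤ)) (by norm_num) (by norm_num) h2
  simp only [shifted] at h3
  omega

/-- The Weyl dimension formula, without denominators. -/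
theorem prod_shifted_eq (k : ℕ) (a : ℕ → ℕ) :
    ∏ i : Fin k, ∏ j ∈ Finset.Ioi i, ((shifted k a j : ℤ) - shifted k a i) =
      (∏ i : Fin k, ∏ j ∈ Finset.Ioi i,
        ((shifted k (fun _ => 0) j : ℤ) - shifted k (fun _ => 0) i)) * schurValue k a := by
  set s := (alternant_zero_dvd k a).choose with hs
  have hspec : alternant k a = alternant k (fun _ => 0) * s :=
    (alternant_zero_dvd k a).choose_spec
  -- `X ^ m = 1 + G m * (X - 1)` exposes a factor `X - 1` in every difference of powers. The same
  -- number cancels on both sides, and `G m` takes the value `m` at one.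
  let G : ℕ → ℤ[X] := fun m => ∑ r ∈ Finset.range m, X ^ r
  have hG : ∀ m, (X : ℤ[X]) ^ m = 1 + G m * (X - 1) := fun m => by
    rw [geom_sum_mul]; ring
  have hG1 : ∀ m, (G m).eval 1 = (m : ℤ) := fun m => by simp [G, eval_finsetSum]
  have hfac : ∀ b : ℕ → ℕ,
      ∏ i : Fin k, ∏ j ∈ Finset.Ioi i, ((X : ℤ[X]) ^ shifted k b j - X ^ shifted k b i) =
      (∏ i : Fin k, ∏ j ∈ Finset.Ioi i, (G (shifted k b j) - G (shifted k b i))) *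
        ∏ i : Fin k, ∏ j ∈ Finset.Ioi i, (X - 1) := by
    intro b
    simp_rw [← Finset.prod_mul_distrib]
    refine Finset.prod_congr rfl fun i _ => Finset.prod_congr rfl fun j _ => ?_
    rw [hG (shifted k b j), hG (shifted k b i)]
    ring
  have hX : (X - 1 : ℤ[X]) ≠ 0 := X_sub_C_ne_zero (1 : ℤ)
  have h1 := congrArg (MvPolynomial.aeval (fun i : Fin k => (X : ℤ[X]) ^ (i : ℕ))) hspec
  rw [map_mul, aeval_alternant, aeval_alternant, hfac, hfac, mul_right_comm] at h1
  have h2 := mul_right_cancel₀ (by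
    rw [Finset.prod_ne_zero_iff]
    intro i _
    rw [Finset.prod_ne_zero_iff]
    exact fun _ _ => hX) h1
  have h3 := congrArg (eval 1) h2
  have h4 : eval 1 (MvPolynomial.aeval (fun i : Fin k => (X : ℤ[X]) ^ (i : ℕ)) s) =
      schurValue k a := by
    have h5 : (evalRingHom (1 : ℤ)).comp
        (MvPolynomial.aeval (fun i : Fin k => (X : ℤ[X]) ^ (i : ℕ))).toRingHom =
        MvPolynomial.eval (fun _ => 1) := by
      apply MvPolynomial.ringHom_ext
      · intro r
        simp
      · intro i
        simp
    exact congrArg (fun f => f s) h5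
  rw [eval_mul, h4] at h3
  simpa only [eval_prod, eval_sub, hG1] using h3

theorem schurValue_zero (k : ℕ) : schurValue k (fun _ => 0) = 1 := by
  have h := prod_shifted_eq k (fun _ => 0)
  have h0 := prod_shifted_zero_ne_zero k
  exact mul_left_cancel₀ h0 (by rw [mul_one]; exact h.symm)

/-- The shifted exponents at `r` and `r + 1` coincide. -/
theorem schurValue_eq_zero {k : ℕ} {a : ℕ → ℕ} {r : ℕ} (hr : r + 1 < k)
    (ha : a (r + 1) = a r + 1) : schurValue k a = 0 := by
  have h := prod_shifted_eq k a
  rw [Finset.prod_eq_zero (i := (⟨r, by omega⟩ : Fin k)) (Finset.mem_univ _)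
    (Finset.prod_eq_zero (i := (⟨r + 1, hr⟩ : Fin k)) (by simp [Fin.lt_def]) (by
      simp only [shifted]
      omega)), eq_comm, mul_eq_zero] at h
  exact h.resolve_left (prod_shifted_zero_ne_zero k)

theorem schurValue_eq_prod (k : ℕ) (a : ℕ → ℕ) :
    (schurValue k a : ℚ) = ∏ i : Fin k, ∏ j ∈ Finset.Ioi i,
      ((a i : ℚ) - (a j : ℚ) + ((j : ℕ) : ℚ) - ((i : ℕ) : ℚ)) /
        (((j : ℕ) : ℚ) - ((i : ℕ) : ℚ)) := by
  have hs : ∀ (b : ℕ → ℕ) (i j : Fin k), (((shifted k b j : ℤ) - shifted k b i : ℤ) : ℚ) =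
      -((b i : ℚ) - (b j : ℚ) + ((j : ℕ) : ℚ) - ((i : ℕ) : ℚ)) := by
    intro b i j
    have h : (shifted k b j : ℤ) - shifted k b i = -((b i : ℤ) - b j + (j : ℕ) - (i : ℕ)) := by
      simp only [shifted]
      omega
    rw [h]
    push_cast
    ring
  have h := congrArg (Int.cast : ℤ → ℚ) (prod_shifted_eq k a)
  have h0 : (((∏ i : Fin k, ∏ j ∈ Finset.Ioi i,
      ((shifted k (fun _ => 0) j : ℤ) - shifted k (fun _ => 0) i) : ℤ)) : ℚ) ≠ 0 :=
    Int.cast_ne_zero.mpr (prod_shifted_zero_ne_zero k)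
  rw [Int.cast_mul, mul_comm] at h
  rw [eq_div_of_mul_eq h0 h.symm, Int.cast_prod, Int.cast_prod, ← Finset.prod_div_distrib]
  refine Finset.prod_congr rfl fun i _ => ?_
  rw [Int.cast_prod, Int.cast_prod, ← Finset.prod_div_distrib]
  refine Finset.prod_congr rfl fun j _ => ?_
  rw [hs, hs, neg_div_neg_eq]
  simp

/-- In the Leibniz term of `s`, the factor `X (s j)` raises exactly the exponent belonging to column
`j`. -/
theorem sum_X_mul_alternant (k : ℕ) (a : ℕ → ℕ) :
    (∑ i : Fin k, (MvPolynomial.X i : MvPolynomial (Fin k) ℤ)) * alternant k a =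
      ∑ j : Fin k, alternant k (Function.update a j (a j + 1)) := by
  simp only [alternant, Matrix.det_apply, Matrix.of_apply]
  rw [Finset.mul_sum, Finset.sum_comm]
  refine Finset.sum_congr rfl fun s _ => ?_
  rw [mul_smul_comm, ← Finset.smul_sum]
  congr 1
  rw [Finset.sum_mul, ← Equiv.sum_comp s]
  refine Finset.sum_congr rfl fun j _ => ?_
  rw [← Finset.mul_prod_erase _ _ (Finset.mem_univ j),
    ← Finset.mul_prod_erase _ _ (Finset.mem_univ j), ← mul_assoc, ← pow_succ',
    Function.update_self]
  congr 1
  · congr 1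
    omega
  · refine Finset.prod_congr rfl fun i hi => ?_
    rw [Function.update_of_ne]
    exact fun h => (Finset.ne_of_mem_erase hi) (Fin.ext h)

/-- The Pieri rule for one box, at one. The sum includes sequences that are not partitions; when `a`
is weakly decreasing these terms vanish by `schurValue_eq_zero`. -/
theorem mul_schurValue (k : ℕ) (a : ℕ → ℕ) :
    (k : ℤ) * schurValue k a =
      ∑ j : Fin k, schurValue k (Function.update a j (a j + 1)) := by
  have hspec : ∀ a, alternant k a = alternant k (fun _ => 0) * (alternant_zero_dvd k a).choose :=
    fun a => (alternant_zero_dvd k a).choose_spec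
  have h := sum_X_mul_alternant k a
  rw [hspec a, Finset.sum_congr rfl fun (j : Fin k) _ =>
    hspec (Function.update a j (a j + 1)), ← Finset.mul_sum, mul_left_comm] at h
  have h1 := congrArg (MvPolynomial.eval fun _ => (1 : ℤ))
    (mul_left_cancel₀ (alternant_zero_ne_zero k) h)
  simp only [map_mul, map_sum, MvPolynomial.eval_X, Finset.sum_const, Finset.card_univ,
    Fintype.card_fin, nsmul_eq_mul, mul_one] at h1
  exact h1

/-! ### Ballot words -/

/-- The number of letters equal to `r` among the first `m` letters. -/
def prefixCount {n k : ℕ} (w : Fin n → Fin k) (m r : ℕ) : ℕ :=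
  (Finset.univ.filter fun i : Fin n => (i : ℕ) < m ∧ (w i : ℕ) = r).card

/-- In every prefix, smaller letters are at least as frequent as larger ones. -/
def IsBallot {n k : ℕ} (w : Fin n → Fin k) : Prop :=
  ∀ m r, prefixCount w m (r + 1) ≤ prefixCount w m r

theorem prefixCount_snoc_of_le {n k : ℕ} (w : Fin n → Fin k) (j : Fin k) {m : ℕ} (hm : m ≤ n)
    (r : ℕ) : prefixCount (Fin.snoc w j : Fin (n + 1) → Fin k) m r = prefixCount w m r := by
  rw [prefixCount, prefixCount, Finset.card_filter, Finset.card_filter, Fin.sum_univ_castSucc]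
  have : ¬ n < m := by omega
  simp [this]

theorem prefixCount_snoc_of_lt {n k : ℕ} (w : Fin n → Fin k) (j : Fin k) {m : ℕ} (hm : n < m)
    (r : ℕ) : prefixCount (Fin.snoc w j : Fin (n + 1) → Fin k) m r =
      Function.update (prefixCount w n) j (prefixCount w n j + 1) r := by
  rw [prefixCount, Finset.card_filter, Fin.sum_univ_castSucc]
  have h1 : ∀ i : Fin n, (i : ℕ) < m := fun i => i.2.trans hm
  simp only [Fin.snoc_castSucc, Fin.snoc_last, Fin.val_castSucc, Fin.val_last, h1, true_and, hm]
  rw [← Finset.card_filter]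
  have h2 : ∀ r, (Finset.univ.filter fun i : Fin n => (w i : ℕ) = r).card = prefixCount w n r := by
    intro r
    simp [prefixCount]
  rw [h2]
  by_cases h : (j : ℕ) = r
  · subst h
    simp
  · rw [if_neg h, Function.update_of_ne (Ne.symm h), add_zero]

theorem isBallot_snoc_iff {n k : ℕ} (w : Fin n → Fin k) (j : Fin k) :
    IsBallot (Fin.snoc w j : Fin (n + 1) → Fin k) ↔ IsBallot w ∧
      ∀ r, Function.update (prefixCount w n) j (prefixCount w n j + 1) (r + 1) ≤
        Function.update (prefixCount w n) j (prefixCount w n j + 1) r := by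
  constructor
  · intro h
    refine ⟨fun m r => ?_, fun r => ?_⟩
    · rcases le_or_gt m n with hm | hm
      · have := h m r
        rwa [prefixCount_snoc_of_le w j hm, prefixCount_snoc_of_le w j hm] at this
      · have := h n r
        rw [prefixCount_snoc_of_le w j le_rfl, prefixCount_snoc_of_le w j le_rfl] at this
        have h2 : ∀ r, prefixCount w m r = prefixCount w n r := fun r => by
          have h1 : ∀ i : Fin n, (i : ℕ) < m := fun i => i.2.trans hm
          simp [prefixCount, h1]
        rwa [h2, h2]
    · have := h (n + 1) r
      rwa [prefixCount_snoc_of_lt w j (Nat.lt_succ_self n),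
        prefixCount_snoc_of_lt w j (Nat.lt_succ_self n)] at this
  · rintro ⟨h1, h2⟩ m r
    rcases le_or_gt m n with hm | hm
    · rw [prefixCount_snoc_of_le w j hm, prefixCount_snoc_of_le w j hm]
      exact h1 m r
    · rw [prefixCount_snoc_of_lt w j hm, prefixCount_snoc_of_lt w j hm]
      exact h2 r

open Classical in
-- Iterated Pieri rule: each letter names the row that receives the next box, and the ballot
-- condition says that all intermediate contents are partitions.
theorem sum_ballot_schurValue (k n : ℕ) :
    ∑ w : Fin n → Fin k, (if IsBallot w then schurValue k (prefixCount w n) else 0) =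
      (k : ℤ) ^ n := by
  induction n with
  | zero =>
    have h1 : ∀ w : Fin 0 → Fin k, IsBallot w := fun w m r => by simp [prefixCount]
    have h2 : ∀ w : Fin 0 → Fin k, prefixCount w 0 = fun _ => 0 := fun w => by
      funext r; simp [prefixCount]
    simp [h1, h2, schurValue_zero]
  | succ n ih =>
    rw [← Equiv.sum_comp (Fin.snocEquiv fun _ => Fin k), Fintype.sum_prod_type_right, pow_succ', ← ih,
      Finset.mul_sum]
    refine Finset.sum_congr rfl fun w _ => ?_
    by_cases hw : IsBallot w
    · rw [if_pos hw, mul_schurValue]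
      refine Finset.sum_congr rfl fun j _ => ?_
      have h1 : prefixCount (Fin.snoc w j : Fin (n + 1) → Fin k) (n + 1) =
          Function.update (prefixCount w n) j (prefixCount w n j + 1) :=
        funext fun r => prefixCount_snoc_of_lt w j (Nat.lt_succ_self n) r
      change (if IsBallot (Fin.snoc w j : Fin (n + 1) → Fin k) then
        schurValue k (prefixCount (Fin.snoc w j : Fin (n + 1) → Fin k) (n + 1)) else 0) = _
      rw [h1]
      split_ifs with h2
      · rfl
      · rw [isBallot_snoc_iff] at h2
        simp only [hw, true_and, not_forall, not_le] at h2
        obtain ⟨r, hr⟩ := h2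
        have h3 := hw n r
        -- A new letter `j` can break the order only against the row just above, when the two counts
        -- were equal; this is the vanishing case.
        have hj : (j : ℕ) = r + 1 := by
          by_contra hne
          rw [Function.update_of_ne (Ne.symm hne)] at hr
          by_cases hjr : (j : ℕ) = r
          · rw [hjr, Function.update_self] at hr
            omega
          · rw [Function.update_of_ne (Ne.symm hjr)] at hr
            omega
        have hlt := j.2
        refine (schurValue_eq_zero (r := r) (by omega) ?_).symm
        rw [hj, Function.update_self, Function.update_of_ne (by omega)] at hr ⊢
        omega
    · rw [if_neg hw, mul_zero]
      refine Finset.sum_eq_zero fun j _ => ?_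
      exact if_neg fun h => hw ((isBallot_snoc_iff w j).mp h).1

/-! ### Gelfand–Tsetlin patterns -/

/-- The determinant of the binomial coefficients of the shifted exponents. -/
def binomialDet (k : ℕ) (a : ℕ → ℕ) : ℤ :=
  Matrix.det (Matrix.of fun i j : Fin k => ((shifted k a i).choose j : ℤ))

/-- Falling factorials are monic of degree `j`, so they may replace the powers in the Vandermonde
determinant; dividing column `j` by `j!` leaves binomial coefficients. -/
theorem prod_shifted_eq_binomialDet (k : ℕ) (a : ℕ → ℕ) :
    ∏ i : Fin k, ∏ j ∈ Finset.Ioi i, ((shifted k a j : ℤ) - shifted k a i) =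
      (∏ i : Fin k, ((i : ℕ).factorial : ℤ)) * binomialDet k a := by
  rw [← Matrix.det_vandermonde (fun j : Fin k => (shifted k a j : ℤ)),
    Matrix.det_eval_matrixOfPolynomials_eq_det_vandermonde _
      (fun i : Fin k => descPochhammer ℤ i) (fun i => descPochhammer_natDegree ℤ i)
      (fun i => monic_descPochhammer ℤ i), binomialDet, ← Matrix.det_mul_row]
  congr 1
  ext1 i j
  simp only [Matrix.of_apply]
  rw [descPochhammer_eval_eq_descFactorial, Nat.descFactorial_eq_factorial_mul_choose,
    Nat.cast_mul]

theorem binomialDet_eq (k : ℕ) (a : ℕ → ℕ) :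
    binomialDet k a = binomialDet k (fun _ => 0) * schurValue k a := by
  have h := prod_shifted_eq k a
  rw [prod_shifted_eq_binomialDet, prod_shifted_eq_binomialDet, mul_assoc] at h
  refine mul_left_cancel₀ ?_ h
  rw [Finset.prod_ne_zero_iff]
  exact fun i _ => Nat.cast_ne_zero.mpr (Nat.factorial_ne_zero _)

theorem binomialDet_zero_ne_zero (k : ℕ) : binomialDet k (fun _ => 0) ≠ 0 := by
  have h := prod_shifted_zero_ne_zero k
  rw [prod_shifted_eq_binomialDet] at h
  exact right_ne_zero_of_mul h

/-- A finite sequence continued by zeros. -/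
def padZero {k : ℕ} (b : Fin k → ℕ) (j : ℕ) : ℕ := if h : j < k then b ⟨j, h⟩ else 0

theorem padZero_apply {k : ℕ} (b : Fin k → ℕ) (j : Fin k) : padZero b j = b j := by
  simp [padZero]

/-- The rows interlacing with the row `a 0, …, a k`. -/
def interlacing (k : ℕ) (a : ℕ → ℕ) : Finset (Fin k → ℕ) :=
  Fintype.piFinset fun j : Fin k => Finset.Icc (a (j + 1)) (a j)

theorem mem_interlacing {k : ℕ} {a : ℕ → ℕ} {b : Fin k → ℕ} :
    b ∈ interlacing k a ↔ ∀ j : Fin k, a (j + 1) ≤ b j ∧ b j ≤ a j := by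
  simp [interlacing]

theorem sum_Icc_choose_add (u v t j : ℕ) (h : u ≤ v) :
    ∑ b ∈ Finset.Icc u v, ((b + t).choose j : ℤ) =
      ((v + 1 + t).choose (j + 1) : ℤ) - ((u + t).choose (j + 1) : ℤ) := by
  induction v, h using Nat.le_induction with
  | base =>
    rw [Finset.Icc_self, Finset.sum_singleton, add_right_comm, Nat.choose_succ_succ]
    push_cast
    ring
  | succ v hv ih =>
    rw [Finset.sum_Icc_succ_top (by omega), ih, add_right_comm (v + 1) 1 t,
      Nat.choose_succ_succ (v + 1 + t) j]
    push_cast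
    ring

/-- The interlacing conditions are independent intervals, so multilinearity moves the sum into the
rows. The hockey-stick identity turns each row into a difference of consecutive rows of the larger
determinant, and those differences reduce its first column to `(1, 0, …, 0)`. The sign comes from
the direction of the differences. -/
theorem sum_binomialDet (k : ℕ) (a : ℕ → ℕ) (ha : ∀ j < k, a (j + 1) ≤ a j) :
    ∑ b ∈ interlacing k a, binomialDet k (padZero b) =
      (-1) ^ k * binomialDet (k + 1) a := by
  have h1 : ∑ b ∈ interlacing k a, binomialDet k (padZero b) =
      Matrix.det (Matrix.of fun i j : Fin k =>
        ((shifted (k + 1) a i).choose (j + 1) : ℤ) -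
          ((shifted (k + 1) a (i + 1)).choose (j + 1) : ℤ)) := by
    have h2 := (Matrix.detRowAlternating (R := ℤ) (n := Fin k)).toMultilinearMap.map_sum_finset
      (fun (i : Fin k) (b : ℕ) (j : Fin k) => ((b + (k - 1 - i)).choose j : ℤ))
      (fun j : Fin k => Finset.Icc (a (j + 1)) (a j))
    refine Eq.trans ?_ (h2.symm.trans ?_)
    · refine Finset.sum_congr rfl fun b _ => ?_
      change _ = Matrix.det _
      rw [binomialDet]
      congr 1
      ext1 i j
      simp [shifted, padZero_apply]
    · change Matrix.det _ = _
      congr 1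
      ext1 i j
      rw [Finset.sum_apply, sum_Icc_choose_add _ _ _ _ (ha i i.2), Matrix.of_apply]
      have hi := i.2
      have e1 : a i + 1 + (k - 1 - (i : ℕ)) = shifted (k + 1) a i := by
        simp only [shifted]; omega
      have e2 : a (i + 1) + (k - 1 - (i : ℕ)) = shifted (k + 1) a (i + 1) := by
        simp only [shifted]; omega
      rw [e1, e2]
  have h3 : binomialDet (k + 1) a = Matrix.det (Matrix.of fun i j : Fin (k + 1) =>
      Fin.cases ((shifted (k + 1) a 0).choose j : ℤ) (fun i' : Fin k =>
        ((shifted (k + 1) a (i' + 1)).choose j : ℤ) - ((shifted (k + 1) a i').choose j : ℤ)) i) := by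
    rw [binomialDet]
    refine Matrix.det_eq_of_forall_row_eq_smul_add_pred (fun _ => 1) (fun j => by simp) ?_
    intro i j
    simp
  rw [h1, h3, Matrix.det_succ_column_zero, Fin.sum_univ_succ, Finset.sum_eq_zero, add_zero]
  · have h4 : (Matrix.of fun i j : Fin k =>
        ((shifted (k + 1) a i).choose (j + 1) : ℤ) -
          ((shifted (k + 1) a (i + 1)).choose (j + 1) : ℤ)) =
        -(Matrix.of fun i j : Fin k =>
        ((shifted (k + 1) a (i + 1)).choose (j + 1) : ℤ) -
          ((shifted (k + 1) a i).choose (j + 1) : ℤ)) := by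
      ext1 i j
      simp
    rw [h4, Matrix.det_neg, Fintype.card_fin]
    congr 1
    simp only [Fin.val_zero, pow_zero, one_mul, Matrix.of_apply, Fin.cases_zero, Nat.choose_zero_right,
      Nat.cast_one]
    congr 1
  · intro i _
    simp

/-- The branching rule for the values at one. -/
theorem sum_interlacing_schurValue (k : ℕ) (a : ℕ → ℕ) (ha : ∀ j < k, a (j + 1) ≤ a j) :
    ∑ b ∈ interlacing k a, schurValue k (padZero b) = schurValue (k + 1) a := by
  have h1 := sum_binomialDet k a ha
  -- The zero row has only the zero row interlacing with it; this case supplies the normalizing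
  -- constant, sign included.
  have h2 := sum_binomialDet k (fun _ => 0) (fun _ _ => le_rfl)
  have h3 : interlacing k (fun _ => 0) = {0} := by
    ext b
    rw [mem_interlacing, Finset.mem_singleton, funext_iff]
    simp
  have h4 : padZero (0 : Fin k → ℕ) = fun _ => 0 := by
    funext j
    simp [padZero]
  rw [h3, Finset.sum_singleton, h4] at h2
  rw [binomialDet_eq (k + 1) a, ← mul_assoc, ← h2,
    Finset.sum_congr rfl fun b _ => binomialDet_eq k (padZero b), ← Finset.mul_sum] at h1
  exact mul_left_cancel₀ (binomialDet_zero_ne_zero k) h1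

/-- The triangular arrays with top row `a`. -/
def triangularArrays (k : ℕ) (a : ℕ → ℕ) : Set (ℕ → ℕ → ℕ) :=
  {x | (∀ i j, k ≤ i + j → x i j = 0) ∧
    (∀ j, j < k → x 0 j = a j) ∧
    ∀ i j, i + j + 1 < k → x (i + 1) j ≤ x i j ∧ x i (j + 1) ≤ x (i + 1) j}

/-- Prepend a row to a triangular array. -/
def consRow (k : ℕ) (a : ℕ → ℕ) (y : ℕ → ℕ → ℕ) : ℕ → ℕ → ℕ
  | 0, j => if j < k + 1 then a j else 0
  | i + 1, j => y i j

theorem consRow_mem {k : ℕ} {a : ℕ → ℕ} {b : Fin k → ℕ} (hb : b ∈ interlacing k a)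
    {y : ℕ → ℕ → ℕ} (hy : y ∈ triangularArrays k (padZero b)) :
    consRow k a y ∈ triangularArrays (k + 1) a := by
  obtain ⟨h1, h2, h3⟩ := hy
  rw [mem_interlacing] at hb
  refine ⟨?_, ?_, ?_⟩
  · rintro (_ | i) j hij
    · exact if_neg (by omega)
    · exact h1 i j (by omega)
  · intro j hj
    exact if_pos hj
  · rintro (_ | i) j hij
    · have hj : j < k := by omega
      have h4 := hb ⟨j, hj⟩
      have h5 : y 0 j = b ⟨j, hj⟩ := by rw [h2 j hj]; exact padZero_apply b ⟨j, hj⟩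
      change y 0 j ≤ (if j < k + 1 then a j else 0) ∧
        (if j + 1 < k + 1 then a (j + 1) else 0) ≤ y 0 j
      rw [if_pos (by omega), if_pos (by omega), h5]
      exact h4.symm
    · exact h3 i j (by omega)

/-- Removing the top row leaves a smaller array whose top row is an arbitrary interlacing row, so
the count satisfies the branching rule. -/
theorem finite_and_card_triangularArrays (k : ℕ) (a : ℕ → ℕ)
    (ha : ∀ j, j + 1 < k → a (j + 1) ≤ a j) :
    Finite (triangularArrays k a) ∧ (Nat.card (triangularArrays k a) : ℤ) = schurValue k a := by
  induction k generalizing a with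
  | zero =>
    have h : triangularArrays 0 a = {fun _ _ => 0} := by
      ext x
      simp only [triangularArrays, Nat.zero_le, forall_const, not_lt_zero, Set.mem_ofPred_eq,
        Set.mem_singleton_iff, funext_iff, IsEmpty.forall_iff, and_true]
    rw [h]
    refine ⟨inferInstance, ?_⟩
    have h1 := prod_shifted_eq 0 a
    simp at h1
    simp [← h1]
  | succ k ih =>
    have hb : ∀ b ∈ interlacing k a, ∀ j, j + 1 < k → padZero b (j + 1) ≤ padZero b j := by
      intro b hb j hj
      rw [mem_interlacing] at hb
      have h1 := (hb ⟨j, by omega⟩).1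
      have h2 := (hb ⟨j + 1, by omega⟩).2
      simp only [padZero, hj, show j < k by omega, dite_true]
      exact h2.trans h1
    let f : (Σ b : interlacing k a, triangularArrays k (padZero b.1)) →
        triangularArrays (k + 1) a := fun z => ⟨consRow k a z.2.1, consRow_mem z.1.2 z.2.2⟩
    have hf : Function.Bijective f := by
      constructor
      · rintro ⟨⟨b, hb⟩, ⟨y, hy⟩⟩ ⟨⟨b', hb'⟩, ⟨y', hy'⟩⟩ h
        have h1 : consRow k a y = consRow k a y' := congrArg Subtype.val h
        obtain rfl : y = y' := by
          funext i j
          exact congrFun (congrFun h1 (i + 1)) j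
        obtain rfl : b = b' := by
          funext j
          rw [← padZero_apply b j, ← padZero_apply b' j, ← hy.2.1 j j.2, ← hy'.2.1 j j.2]
        rfl
      · rintro ⟨x, hx⟩
        obtain ⟨h1, h2, h3⟩ := hx
        refine ⟨⟨⟨fun j => x 1 j, ?_⟩, ⟨fun i => x (i + 1), ?_, ?_, ?_⟩⟩, ?_⟩
        · rw [mem_interlacing]
          intro j
          have hj := j.2
          have h4 := h3 0 j (by omega)
          rw [h2 j (by omega), h2 (j + 1) (by omega)] at h4
          exact h4.symm
        · exact fun i j hij => h1 (i + 1) j (by omega)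
        · intro j hj
          exact (padZero_apply (fun j : Fin k => x 1 j) ⟨j, hj⟩).symm
        · exact fun i j hij => h3 (i + 1) j (by omega)
        · apply Subtype.ext
          funext i j
          cases i with
          | zero =>
            change (if j < k + 1 then a j else 0) = x 0 j
            split_ifs with hj
            · exact (h2 j hj).symm
            · exact (h1 0 j (by omega)).symm
          | succ i => rfl
    have hfin : ∀ b : interlacing k a, Finite (triangularArrays k (padZero b.1)) :=
      fun b => (ih _ (hb b.1 b.2)).1
    refine ⟨Finite.of_surjective f hf.2, ?_⟩
    rw [← Nat.card_congr (Equiv.ofBijective f hf), Nat.card_sigma,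
      ← sum_interlacing_schurValue k a (fun j hj => ha j (by omega)), Nat.cast_sum,
      ← Finset.sum_coe_sort (interlacing k a)]
    exact Finset.sum_congr rfl fun b _ => (ih _ (hb b.1 b.2)).2

theorem part_antitone {n : ℕ} (l : n.Partition) : Antitone (part l) := by
  intro i j hij
  rw [part_eq_rowLen, part_eq_rowLen]
  exact YoungDiagram.rowLen_anti _ _ _ hij

theorem length_le_iff {n : ℕ} (l : n.Partition) (k : ℕ) : length l ≤ k ↔ part l k = 0 := by
  have h : (sortedParts l).length = length l := Multiset.length_sort _
  rw [← h, part]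
  constructor
  · exact fun hk => List.getD_eq_default _ _ hk
  · intro hk
    by_contra! hlt
    rw [List.getD_eq_getElem _ _ hlt] at hk
    have h1 : (sortedParts l)[k] ∈ l.parts :=
      (Multiset.mem_sort (· ≥ ·)).mp (List.getElem_mem hlt)
    exact (l.parts_pos h1).ne' hk

theorem gtCount_eq {n : ℕ} (k : ℕ) (l : n.Partition) :
    (gtCount k l : ℤ) = schurValue k (part l) :=
  (finite_and_card_triangularArrays k (part l) fun j _ => part_antitone l (Nat.le_succ j)).2

/-! ### Gelfand–Tsetlin patterns as semistandard fillings -/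

/-- Permutations of the positions acting on words. -/
def wordAction (n k : ℕ) : Equiv.Perm (Fin n) →* Equiv.Perm (Fin n → Fin k) where
  toFun g := Equiv.arrowCongr g (Equiv.refl _)
  map_one' := rfl
  map_mul' _ _ := rfl

theorem wordAction_apply {n k : ℕ} (g : Equiv.Perm (Fin n)) (w : Fin n → Fin k) (i : Fin n) :
    wordAction n k g w i = w (g⁻¹ i) := rfl

/-- The number of rows of a triangular array that reach beyond column `c` at position `r`. -/
def rowsBeyond (k : ℕ) (x : ℕ → ℕ → ℕ) (r c : ℕ) : ℕ :=
  ((Finset.range k).filter fun m => c < x m r).card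

theorem triangularArrays_antitone {k : ℕ} {a : ℕ → ℕ} {x : ℕ → ℕ → ℕ}
    (hx : x ∈ triangularArrays k a) (r : ℕ) : Antitone fun m => x m r := by
  refine antitone_nat_of_succ_le fun m => ?_
  by_cases h : m + r + 1 < k
  · exact (hx.2.2 m r h).1
  · rw [hx.1 (m + 1) r (by omega)]
    exact Nat.zero_le _

theorem lt_rowsBeyond_iff {k : ℕ} {a : ℕ → ℕ} {x : ℕ → ℕ → ℕ}
    (hx : x ∈ triangularArrays k a) (r c m : ℕ) : m < rowsBeyond k x r c ↔ c < x m r := by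
  have hanti := triangularArrays_antitone hx r
  constructor
  · intro h
    by_contra hcon
    have hsub : (Finset.range k).filter (fun m => c < x m r) ⊆ Finset.range m := by
      intro m' hm'
      rw [Finset.mem_filter] at hm'
      rw [Finset.mem_range]
      by_contra hle
      exact hcon (hm'.2.trans_le (hanti (not_lt.mp hle)))
    have := Finset.card_le_card hsub
    rw [Finset.card_range] at this
    exact absurd h (not_lt.mpr this)
  · intro h
    have hmk : m < k := by
      by_contra hle
      rw [hx.1 m r (by omega)] at h
      omega
    have hsub : Finset.range (m + 1) ⊆ (Finset.range k).filter (fun m => c < x m r) := by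
      intro m' hm'
      rw [Finset.mem_range] at hm'
      rw [Finset.mem_filter, Finset.mem_range]
      exact ⟨by omega, h.trans_le (hanti (by omega))⟩
    have := Finset.card_le_card hsub
    rw [Finset.card_range] at this
    exact this

open Classical in
-- Row `m` of a pattern is read as the shape occupied by the entries smaller than `k - m`.
-- Injectivity of this reading suffices for the squeeze.
theorem gtCount_le_card_semistandard {n k : ℕ} (l : n.Partition) (hl : length l ≤ k) :
    gtCount k l ≤ (Finset.univ.filter fun w : Fin n → Fin k =>
      IsSemistandard l fun i => (w i : ℕ)).card := by
  have hrow : ∀ i, rowOf l i < k := by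
    intro i
    by_contra hle
    have h1 := (mem_diagram l _).mp (box_mem l i)
    have h2 := part_antitone l (not_lt.mp hle)
    rw [(length_le_iff l k).mp hl] at h2
    simp only at h1
    omega
  have hpos : ∀ x ∈ gtPatterns k l, ∀ i, 0 < rowsBeyond k x (rowOf l i) (colOf l i) := by
    intro x hx i
    rw [lt_rowsBeyond_iff (a := part l) hx, hx.2.1 _ (hrow i)]
    exact (mem_diagram l _).mp (box_mem l i)
  -- The value is `k - rowsBeyond`, because `rowsBeyond` is positive on boxes of the shape; the
  -- detour through `k - 1` keeps it below `k` for every `x`.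
  let f : (ℕ → ℕ → ℕ) → Fin n → Fin k := fun x i =>
    ⟨k - 1 - (rowsBeyond k x (rowOf l i) (colOf l i) - 1), by have := hrow i; omega⟩
  have hle : ∀ x r c, rowsBeyond k x r c ≤ k := fun x r c =>
    (Finset.card_filter_le _ _).trans (Finset.card_range k).le
  have hmono : ∀ x r c c', c ≤ c' → rowsBeyond k x r c' ≤ rowsBeyond k x r c := by
    intro x r c c' hc
    refine Finset.card_le_card fun m hm => ?_
    rw [Finset.mem_filter] at hm ⊢
    exact ⟨hm.1, hc.trans_lt hm.2⟩
  have hcol : ∀ x ∈ gtPatterns k l, ∀ r r' c, r < r' → 0 < rowsBeyond k x r' c →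
      rowsBeyond k x r' c < rowsBeyond k x r c := by
    intro x hx r r' c hr hp
    -- The interlacing inequality `x m (r + 1) ≤ x (m + 1) r` gives one more row reaching column `c`
    -- at position `r` than at `r + 1`.
    have hstep : ∀ r, 0 < rowsBeyond k x (r + 1) c →
        rowsBeyond k x (r + 1) c < rowsBeyond k x r c := by
      intro r hp
      obtain ⟨m, hm⟩ := Nat.exists_eq_add_of_lt hp
      have h1 := (lt_rowsBeyond_iff (a := part l) hx (r + 1) c m).mp (by omega)
      have h2 : m + r + 1 < k := by
        by_contra hcon
        rw [hx.1 m (r + 1) (by omega)] at h1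
        omega
      have h3 := (lt_rowsBeyond_iff (a := part l) hx r c (m + 1)).mpr
        (h1.trans_le (hx.2.2 m r h2).2)
      omega
    induction r', hr using Nat.le_induction with
    | base => exact hstep r hp
    | succ r' hr' ih =>
      have h1 := hstep r' hp
      exact h1.trans (ih (by omega))
  rw [gtCount, ← Set.ncard_coe_finset]
  refine Set.ncard_le_ncard_of_injOn f ?_ ?_ (Finset.finite_toSet _)
  · intro x hx
    rw [Finset.mem_coe, Finset.mem_filter]
    refine ⟨Finset.mem_univ _, ⟨?_, ?_⟩⟩
    · intro i j hr hc
      simp only [f]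
      have := hmono x (rowOf l i) _ _ hc
      rw [← hr]
      omega
    · intro i j hc hr
      simp only [f]
      have h1 := hpos x hx j
      have h2 := hle x (rowOf l i) (colOf l i)
      have h3 := hcol x hx _ _ (colOf l i) hr (by rw [hc]; exact h1)
      rw [← hc] at h1 ⊢
      omega
  · intro x hx y hy hxy
    have key : ∀ x ∈ gtPatterns k l, ∀ y ∈ gtPatterns k l, f x = f y →
        ∀ m r c, c < x m r → c < y m r := by
      intro x hx y hy hxy m r c h
      have h0 : c < x 0 r :=
        h.trans_le (triangularArrays_antitone (a := part l) hx r (Nat.zero_le m))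
      have hrk : r < k := by
        by_contra hcon
        rw [hx.1 0 r (by omega)] at h0
        omega
      rw [hx.2.1 r hrk] at h0
      obtain ⟨i, hi1, hi2⟩ := exists_box l (u := (r, c)) ((mem_diagram l _).mpr h0)
      simp only at hi1 hi2
      have h1 := congrArg Fin.val (congrFun hxy i)
      simp only [f] at h1
      have h2 := hpos x hx i
      have h3 := hpos y hy i
      have h4 := hle x (rowOf l i) (colOf l i)
      have h5 := hle y (rowOf l i) (colOf l i)
      rw [hi1, hi2] at h1 h2 h3 h4 h5
      rw [← lt_rowsBeyond_iff (a := part l) hx] at h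
      rw [← lt_rowsBeyond_iff (a := part l) hy]
      omega
    funext m r
    refine eq_of_forall_lt_iff fun c => ⟨key x hx y hy hxy m r c, key y hy x hx hxy.symm m r c⟩

/-! ### Ballot words as standard fillings -/

theorem prefixCount_mono {n k : ℕ} (w : Fin n → Fin k) (r : ℕ) :
    Monotone fun m => prefixCount w m r := by
  intro m m' hm
  refine Finset.card_le_card fun i hi => ?_
  rw [Finset.mem_filter] at hi ⊢
  exact ⟨hi.1, hi.2.1.trans_le hm, hi.2.2⟩

theorem prefixCount_succ {n k : ℕ} (w : Fin n → Fin k) (m : Fin n) :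
    prefixCount w (m + 1) (w m) = prefixCount w m (w m) + 1 := by
  have h : (Finset.univ.filter fun i : Fin n => (i : ℕ) < m + 1 ∧ (w i : ℕ) = w m) =
      insert m (Finset.univ.filter fun i : Fin n => (i : ℕ) < m ∧ (w i : ℕ) = w m) := by
    ext i
    simp only [Finset.mem_filter, Finset.mem_univ, true_and, Finset.mem_insert]
    constructor
    · rintro ⟨h1, h2⟩
      by_cases him : i = m
      · exact Or.inl him
      · exact Or.inr ⟨by have : (i : ℕ) ≠ m := fun h => him (Fin.ext h)
                         omega, h2⟩
    · rintro (rfl | ⟨h1, h2⟩)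
      · exact ⟨by omega, rfl⟩
      · exact ⟨by omega, h2⟩
  rw [prefixCount, h, Finset.card_insert_of_notMem (by simp), prefixCount]

theorem prefixCount_lt {n k : ℕ} (w : Fin n → Fin k) {m m' : Fin n} (h : m < m') :
    prefixCount w m (w m) < prefixCount w m' (w m) := by
  have h1 := prefixCount_mono w (w m) (show (m : ℕ) + 1 ≤ m' from h)
  simp only [prefixCount_succ] at h1
  omega

theorem IsBallot.antitone {n k : ℕ} {w : Fin n → Fin k} (hw : IsBallot w) (m : ℕ) :
    Antitone (prefixCount w m) := antitone_nat_of_succ_le fun r => hw m r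

/-- Letter number `m` takes the next free box of row `w m`, so its column is the number of earlier
equal letters. -/
theorem IsBallot.exists_filling {n k : ℕ} {w : Fin n → Fin k} (hw : IsBallot w) (l : n.Partition)
    (hl : prefixCount w n = part l) :
    ∃ x : Equiv.Perm (Fin n), (IsSemistandard l fun i => ((x⁻¹ i : Fin n) : ℕ)) ∧
      ∀ m, rowOf l (x m) = w m := by
  have hmem : ∀ m : Fin n, ((w m : ℕ), prefixCount w m (w m)) ∈ diagram l := by
    intro m
    rw [mem_diagram, ← hl]
    have h1 := prefixCount_mono w (w m) (show (m : ℕ) + 1 ≤ n from m.2)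
    simp only [prefixCount_succ] at h1 ⊢
    omega
  let f : Fin n → Fin n := fun m => (tableau l).symm ⟨_, hmem m⟩
  have hr : ∀ m, rowOf l (f m) = w m := fun m => by simp [f, rowOf]
  have hc : ∀ m, colOf l (f m) = prefixCount w m (w m) := fun m => by simp [f, colOf]
  have hinj : Function.Injective f := by
    intro m m' h
    have h1 : (w m : ℕ) = w m' := by rw [← hr, ← hr, h]
    have h2 : prefixCount w m (w m) = prefixCount w m' (w m') := by rw [← hc, ← hc, h]
    rcases lt_trichotomy m m' with hlt | heq | hlt
    · have := prefixCount_lt w hlt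
      rw [h2, h1] at this
      omega
    · exact heq
    · have := prefixCount_lt w hlt
      rw [← h2, ← h1] at this
      omega
  let x : Equiv.Perm (Fin n) := Equiv.ofBijective f (Finite.injective_iff_bijective.mp hinj)
  have key : ∀ P : Fin n → Fin n → Prop, (∀ m m', P (f m) (f m')) → ∀ i j, P i j := by
    intro P h i j
    have h1 : ∀ i, f (x⁻¹ i) = i := fun i => x.apply_symm_apply i
    rw [← h1 i, ← h1 j]
    exact h _ _
  have hinv : ∀ m, x⁻¹ (f m) = m := fun m => x.symm_apply_apply m
  refine ⟨x, ⟨?_, ?_⟩, hr⟩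
  · apply key
    intro m m' h1 h2
    rw [hr, hr] at h1
    rw [hc, hc] at h2
    rw [hinv, hinv]
    by_contra hcon
    have := prefixCount_lt w (Fin.lt_def.mpr (not_le.mp hcon))
    rw [← h1] at this h2
    omega
  · apply key
    intro m m' h1 h2
    rw [hr, hr] at h2
    rw [hc, hc] at h1
    rw [hinv, hinv]
    by_contra hcon
    have hlt : (m' : ℕ) + 1 ≤ m := by
      rcases (not_lt.mp hcon).eq_or_lt with h | h
      · rw [Fin.ext h] at h2
        omega
      · exact h
    -- If the lower box of a column were filled first, then just after that the lower row would be
    -- longer than the upper one.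
    have h3 := hw.antitone (m' + 1) h2.le
    have h4 := prefixCount_mono w (w m) hlt
    simp only [prefixCount_succ] at h3 h4
    omega

open Classical in
theorem card_ballot_le_card_standard {n : ℕ} (k : ℕ) (l : n.Partition) :
    (Finset.univ.filter fun w : Fin n → Fin k => IsBallot w ∧ prefixCount w n = part l).card ≤
      (Finset.univ.filter fun x : Equiv.Perm (Fin n) =>
        IsSemistandard l fun i => ((x⁻¹ i : Fin n) : ℕ)).card := by
  have h : ∀ w : Fin n → Fin k, ∃ x : Equiv.Perm (Fin n),
      IsBallot w ∧ prefixCount w n = part l →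
      (IsSemistandard l fun i => ((x⁻¹ i : Fin n) : ℕ)) ∧ ∀ m, rowOf l (x m) = w m := by
    intro w
    by_cases hw : IsBallot w ∧ prefixCount w n = part l
    · obtain ⟨x, hx⟩ := hw.1.exists_filling l hw.2
      exact ⟨x, fun _ => hx⟩
    · exact ⟨1, fun h => absurd h hw⟩
  choose f hf using h
  refine Finset.card_le_card_of_injOn f ?_ ?_
  · intro w hw
    simp only [Finset.coe_filter, Finset.mem_univ, true_and, Set.mem_ofPred_eq] at hw ⊢
    exact (hf w hw).1
  · intro w hw w' hw' hww
    simp only [Finset.coe_filter, Finset.mem_univ, true_and, Set.mem_ofPred_eq] at hw hw'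
    funext m
    apply Fin.ext
    rw [← (hf w hw).2 m, ← (hf w' hw').2 m, hww]

theorem exists_diagram_eq {n : ℕ} (μ : YoungDiagram) (h : μ.cells.card = n) :
    ∃ l : n.Partition, diagram l = μ := by
  have hsum : μ.rowLens.sum = n := by
    rw [← card_cellsOfRowLens, ← h]
    exact congrArg (fun ν : YoungDiagram => ν.cells.card)
      (YoungDiagram.ofRowLens_to_rowLens_eq_self (μ := μ))
  refine ⟨⟨μ.rowLens, fun {i} hi => μ.pos_of_mem_rowLens i hi, hsum⟩, ?_⟩
  have h1 : Multiset.sort (μ.rowLens : Multiset ℕ) (· ≥ ·) = μ.rowLens :=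
    List.mergeSort_of_pairwise (by simpa using μ.rowLens_sorted.pairwise)
  ext u
  rw [YoungDiagram.mem_cells, YoungDiagram.mem_cells, diagram]
  conv_rhs => rw [← YoungDiagram.ofRowLens_to_rowLens_eq_self (μ := μ)]
  rw [YoungDiagram.mem_ofRowLens, YoungDiagram.mem_ofRowLens]
  simp only [sortedParts, h1]

theorem prefixCount_eq_zero {n k : ℕ} (w : Fin n → Fin k) (m : ℕ) {r : ℕ} (hr : k ≤ r) :
    prefixCount w m r = 0 := by
  rw [prefixCount, Finset.card_eq_zero, Finset.filter_eq_empty_iff]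
  intro i _ h
  have := (w i).2
  omega

theorem IsBallot.exists_partition {n k : ℕ} {w : Fin n → Fin k} (hw : IsBallot w) :
    ∃ l : n.Partition, prefixCount w n = part l := by
  let μ : YoungDiagram :=
    { cells := (Finset.range k).sigma (fun r => Finset.range (prefixCount w n r)) |>.map
        (Equiv.sigmaEquivProd ℕ ℕ).toEmbedding
      isLowerSet := by
        rintro ⟨r, c⟩ ⟨r', c'⟩ h hrc
        obtain ⟨h1, h2⟩ := Prod.mk_le_mk.mp h
        simp at hrc ⊢
        have := hw.antitone n h1
        exact ⟨by omega, by omega⟩ }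
  have hμ : ∀ r c, (r, c) ∈ μ ↔ c < prefixCount w n r := by
    intro r c
    rw [← YoungDiagram.mem_cells]
    simp [μ]
    intro h
    by_contra hcon
    rw [prefixCount_eq_zero w n (not_lt.mp hcon)] at h
    omega
  have hcard : μ.cells.card = n := by
    simp only [μ, Finset.card_map, Finset.card_sigma, Finset.card_range]
    have h1 := Finset.card_eq_sum_card_fiberwise (s := (Finset.univ : Finset (Fin n)))
      (t := Finset.range k) (f := fun i => (w i : ℕ)) (by intro i _; simp)
    rw [Finset.card_univ, Fintype.card_fin] at h1
    conv_rhs => rw [h1]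
    refine Finset.sum_congr rfl fun r _ => ?_
    simp [prefixCount]
  obtain ⟨l, hl⟩ := exists_diagram_eq μ hcard
  refine ⟨l, funext fun r => eq_of_forall_lt_iff fun c => ?_⟩
  rw [← hμ, ← hl, mem_diagram]

/-! ### Multiplicities -/

open Classical in
theorem sum_schurAtOne_mul_card_ballot (n k : ℕ) :
    ∑ l : n.Partition, schurAtOne k l * ((Finset.univ.filter fun w : Fin n → Fin k =>
      IsBallot w ∧ prefixCount w n = part l).card : ℤ) = (k : ℤ) ^ n := by
  have h : ∀ w : Fin n → Fin k, ∃ l : n.Partition, IsBallot w → prefixCount w n = part l := by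
    intro w
    by_cases hw : IsBallot w
    · obtain ⟨l, hl⟩ := hw.exists_partition
      exact ⟨l, fun _ => hl⟩
    · exact ⟨Nat.Partition.indiscrete n, fun h => absurd h hw⟩
  choose f hf using h
  rw [← sum_ballot_schurValue k n, ← Finset.sum_filter,
    ← Finset.sum_fiberwise_of_maps_to (t := Finset.univ) (g := f) (by simp)]
  refine Finset.sum_congr rfl fun l _ => ?_
  have h1 : (Finset.univ.filter fun w : Fin n → Fin k =>
      IsBallot w ∧ prefixCount w n = part l) =
      (Finset.univ.filter fun w : Fin n → Fin k => IsBallot w).filter fun w => f w = l := by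
    ext w
    simp only [Finset.mem_filter, Finset.mem_univ, true_and]
    refine and_congr_right fun hw => ?_
    rw [hf w hw]
    exact ⟨eq_of_part_eq, fun h => by rw [h]⟩
  rw [h1, mul_comm, ← nsmul_eq_mul, ← Finset.sum_const]
  refine Finset.sum_congr rfl fun w hw => ?_
  rw [← h1, Finset.mem_filter] at hw
  rw [hw.2.2, schurAtOne_eq]
  rw [length_le_iff, ← hw.2.2]
  exact prefixCount_eq_zero w n le_rfl

theorem permCharacter_one {n : ℕ} (l : n.Partition) :
    permCharacter l 1 = (hookScalar l)⁻¹ * n.factorial := by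
  rw [permCharacter_eq]
  simp [coeff_youngSymmetrizer_one, Fintype.card_perm]

theorem schurAtOne_nonneg {n : ℕ} (k : ℕ) (l : n.Partition) : 0 ≤ schurAtOne k l := by
  by_cases h : length l ≤ k
  · rw [schurAtOne_eq h, ← gtCount_eq]
    exact Int.natCast_nonneg _
  · rw [schurAtOne_eq_zero h]

/-- The number of words fixed by a permutation of the positions. -/
noncomputable def fixedWords (k : ℕ) {n : ℕ} (g : Equiv.Perm (Fin n)) : ℕ :=
  (Finset.univ.filter fun w : Fin n → Fin k => wordAction n k g w = w).card

theorem fixedWords_conj (k : ℕ) {n : ℕ} (g a : Equiv.Perm (Fin n)) :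
    fixedWords k (a * g * a⁻¹) = fixedWords k g := by
  refine Finset.card_bij' (fun w _ => wordAction n k a⁻¹ w) (fun w _ => wordAction n k a w)
    ?_ ?_ ?_ ?_
  · intro w hw
    simp only [Finset.mem_filter, Finset.mem_univ, true_and, map_mul, Equiv.Perm.mul_apply] at hw ⊢
    conv_rhs => rw [← hw]
    simp
  · intro w hw
    simp only [Finset.mem_filter, Finset.mem_univ, true_and, map_mul, Equiv.Perm.mul_apply] at hw ⊢
    simpa using hw
  · intro w _
    simp
  · intro w _
    simp

/-- The multiplicity of an irreducible character in the permutation character on words. -/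
theorem multiplicity_eq_schurAtOne {n : ℕ} (k : ℕ) (l : n.Partition) :
    (hookScalar l)⁻¹ * ∑ g, (youngSymmetrizer l).coeff g * (fixedWords k g : ℂ) =
      schurAtOne k l := by
  classical
  have hN : ∀ l : n.Partition, ∃ N : ℕ, schurAtOne k l ≤ N ∧
      (hookScalar l)⁻¹ * ∑ g, (youngSymmetrizer l).coeff g * (fixedWords k g : ℂ) = N := by
    intro l
    obtain ⟨N, h1, h2⟩ := exists_multiplicity l (wordAction n k)
      (fun w i => (w i : ℕ)) (fun w w' h => funext fun i => Fin.ext (congrFun h i))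
      (fun g w i => rfl) (Finset.univ.filter fun w : Fin n → Fin k =>
        IsSemistandard l fun i => (w i : ℕ)) (fun w hw => (Finset.mem_filter.mp hw).2)
    refine ⟨N, ?_, ?_⟩
    · by_cases h : length l ≤ k
      · rw [schurAtOne_eq h, ← gtCount_eq]
        exact_mod_cast (gtCount_le_card_semistandard l h).trans h1
      · rw [schurAtOne_eq_zero h]
        exact Int.natCast_nonneg _
    · rw [← h2]
      simp only [fixedWords]
  -- This uses the regular representation: only the identity has fixed points there, so the
  -- multiplicity is the degree of the character.
  have hf : ∀ l : n.Partition, ∃ f : ℕ, (Finset.univ.filter fun w : Fin n → Fin k =>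
      IsBallot w ∧ prefixCount w n = part l).card ≤ f ∧ 0 < f ∧ permCharacter l 1 = f := by
    intro l
    obtain ⟨f, h1, h2⟩ := exists_multiplicity l
      (MulAction.toPermHom (Equiv.Perm (Fin n)) (Equiv.Perm (Fin n)))
      (fun x i => ((x⁻¹ i : Fin n) : ℕ)) (fun x x' h => by
        have h3 : x⁻¹ = x'⁻¹ := Equiv.ext fun i => Fin.ext (congrFun h i)
        exact inv_injective h3)
      (fun g x i => by simp) (Finset.univ.filter fun x : Equiv.Perm (Fin n) =>
        IsSemistandard l fun i => ((x⁻¹ i : Fin n) : ℕ)) (fun w hw => (Finset.mem_filter.mp hw).2)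
    have h3 : permCharacter l 1 = f := by
      rw [permCharacter_one, ← h2]
      congr 1
      rw [Finset.sum_eq_single 1]
      · simp [coeff_youngSymmetrizer_one, Fintype.card_perm]
      · intro g _ hg
        simp [hg]
      · simp
    refine ⟨f, (card_ballot_le_card_standard k l).trans h1, Nat.pos_of_ne_zero ?_, h3⟩
    rintro rfl
    rw [permCharacter_one, Nat.cast_zero, mul_eq_zero] at h3
    rcases h3 with h3 | h3
    · exact hookScalar_ne_zero l (inv_eq_zero.mp h3)
    · exact Nat.factorial_ne_zero n (by exact_mod_cast h3)
  choose N hN1 hN2 using hN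
  choose f hf1 hf2 hf3 using hf
  have hsum : ∑ l, (N l : ℤ) * f l = (k : ℤ) ^ n := by
    have h1 := classFunction_eq_sum (fun g : Equiv.Perm (Fin n) => (fixedWords k g : ℂ))
      (fun g a => by rw [fixedWords_conj]) 1
    simp_rw [hN2, hf3] at h1
    have h2 : fixedWords k (1 : Equiv.Perm (Fin n)) = k ^ n := by
      simp [fixedWords]
    rw [h2] at h1
    exact_mod_cast h1.symm
  rw [← sum_schurAtOne_mul_card_ballot n k] at hsum
  have hle : ∀ l ∈ Finset.univ, schurAtOne k l * ((Finset.univ.filter fun w : Fin n → Fin k =>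
      IsBallot w ∧ prefixCount w n = part l).card : ℤ) ≤ (N l : ℤ) * f l := fun l _ =>
    mul_le_mul (hN1 l) (by exact_mod_cast hf1 l) (Int.natCast_nonneg _) (Int.natCast_nonneg _)
  -- Termwise inequalities with equal totals are equalities; the positive degree can then be
  -- cancelled.
  have heq := (Finset.sum_eq_sum_iff_of_le hle).mp hsum.symm l (Finset.mem_univ l)
  have h1 : schurAtOne k l * ((Finset.univ.filter fun w : Fin n → Fin k =>
      IsBallot w ∧ prefixCount w n = part l).card : ℤ) ≤ schurAtOne k l * f l :=
    mul_le_mul_of_nonneg_left (by exact_mod_cast hf1 l) (schurAtOne_nonneg k l)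
  rw [heq] at h1
  have h2 : (N l : ℤ) ≤ schurAtOne k l :=
    le_of_mul_le_mul_right h1 (by exact_mod_cast hf2 l)
  rw [hN2, le_antisymm (hN1 l) h2]
  simp

theorem fixedWords_eq_sum {n : ℕ} (k : ℕ) (g : Equiv.Perm (Fin n)) :
    (fixedWords k g : ℂ) = ∑ l : n.Partition, (schurAtOne k l : ℂ) * permCharacter l g := by
  rw [classFunction_eq_sum (fun g : Equiv.Perm (Fin n) => (fixedWords k g : ℂ))
      (fun g a => by rw [fixedWords_conj])]
  simp_rw [multiplicity_eq_schurAtOne]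

/-! ### Hook lengths -/

/-- The factors of the two products are distinct, disjoint families, and by counting they exhaust
the integers from `1` to `lam i + (k - 1 - i)`. -/
theorem prod_hook_mul_prod_sub {k : ℕ} (lam kap : ℕ → ℕ) (hlam : Antitone lam)
    (hkap : Antitone kap) (hrel : ∀ i c, c < lam i ↔ i < kap c) (hk : ∀ c, kap c ≤ k) {i : ℕ}
    (hi : i < k) :
    (∏ c ∈ Finset.range (lam i), (lam i + kap c - i - c - 1)) *
      ∏ j ∈ Finset.Ioo i k, (lam i + j - lam j - i) = (lam i + (k - 1 - i)).factorial := by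
  have hA : Set.InjOn (fun c => lam i + kap c - i - c - 1) (Finset.range (lam i)) := by
    intro c hc c' hc' h
    simp only [Finset.coe_range, Set.mem_Iio] at hc hc' h
    have h1 := (hrel i c).mp hc
    have h2 := (hrel i c').mp hc'
    rcases lt_trichotomy c c' with hlt | heq | hlt
    · have := hkap hlt.le
      omega
    · exact heq
    · have := hkap hlt.le
      omega
  have hB : Set.InjOn (fun j => lam i + j - lam j - i) (Finset.Ioo i k) := by
    intro j hj j' hj' h
    simp only [Finset.coe_Ioo, Set.mem_Ioo] at hj hj' h
    have h1 := hlam hj.1.le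
    have h2 := hlam hj'.1.le
    rcases lt_trichotomy j j' with hlt | heq | hlt
    · have := hlam hlt.le
      omega
    · exact heq
    · have := hlam hlt.le
      omega
  have hdisj : Disjoint ((Finset.range (lam i)).image fun c => lam i + kap c - i - c - 1)
      ((Finset.Ioo i k).image fun j => lam i + j - lam j - i) := by
    rw [Finset.disjoint_left]
    intro m hm hm'
    obtain ⟨c, hc, rfl⟩ := Finset.mem_image.mp hm
    obtain ⟨j, hj, h⟩ := Finset.mem_image.mp hm'
    rw [Finset.mem_range] at hc
    rw [Finset.mem_Ioo] at hj
    have h1 := (hrel i c).mp hc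
    have h2 := hlam hj.1.le
    -- A coincidence would mean `kap c + lam j = c + j + 1`. The sum is at least `c + j + 2` if the
    -- box `(j, c)` lies in the diagram, and at most `c + j` otherwise.
    by_cases h3 : c < lam j
    · have := (hrel j c).mp h3
      omega
    · have : ¬ j < kap c := fun h4 => h3 ((hrel j c).mpr h4)
      omega
  have hunion : ((Finset.range (lam i)).image fun c => lam i + kap c - i - c - 1) ∪
      ((Finset.Ioo i k).image fun j => lam i + j - lam j - i) =
      Finset.Icc 1 (lam i + (k - 1 - i)) := by
    refine Finset.eq_of_subset_of_card_le ?_ ?_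
    · intro m hm
      rw [Finset.mem_Icc]
      rcases Finset.mem_union.mp hm with hm | hm
      · obtain ⟨c, hc, rfl⟩ := Finset.mem_image.mp hm
        rw [Finset.mem_range] at hc
        have h1 := (hrel i c).mp hc
        have h2 := hk c
        omega
      · obtain ⟨j, hj, rfl⟩ := Finset.mem_image.mp hm
        rw [Finset.mem_Ioo] at hj
        have h2 := hlam hj.1.le
        omega
    · rw [Finset.card_union_of_disjoint hdisj, Finset.card_image_of_injOn hA,
        Finset.card_image_of_injOn hB, Finset.card_range, Nat.card_Ioo, Nat.card_Icc]
      omega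
  rw [← Finset.prod_Ico_id_eq_factorial, Finset.Ico_add_one_right_eq_Icc, ← hunion, Finset.prod_union hdisj, Finset.prod_image hA,
    Finset.prod_image hB]

/-- The numerators `k + content` multiply to a quotient of the factorials of `part l i + (k - 1 -
i)` and `k - 1 - i`, so the claim is the preceding factorial identity rearranged. -/
theorem prod_row_eq {n : ℕ} {k : ℕ} (l : n.Partition) (hl : length l ≤ k) {i : ℕ} (hi : i < k) :
    ∏ c ∈ Finset.range (part l i), ((k : ℚ) + content (i, c)) / (hookLength l (i, c) : ℚ) =
      ∏ j ∈ Finset.Ioo i k, ((part l i : ℚ) - (part l j : ℚ) + (j : ℚ) - (i : ℚ)) /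
        ((j : ℚ) - (i : ℚ)) := by
  have hrel : ∀ r c, c < part l r ↔ r < (diagram l).colLen c := by
    intro r c
    rw [← YoungDiagram.mem_iff_lt_colLen, mem_diagram]
  have hk : ∀ c, (diagram l).colLen c ≤ k := by
    intro c
    by_contra! h
    rw [← hrel, (length_le_iff l k).mp hl] at h
    omega
  have h1 := prod_hook_mul_prod_sub (k := k) (part l) (diagram l).colLen (part_antitone l)
    (fun c c' h => YoungDiagram.colLen_anti _ _ _ h) hrel hk hi
  have h2 : ((∏ c ∈ Finset.range (part l i), (part l i + (diagram l).colLen c - i - c - 1) : ℕ) : ℚ)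
      = ∏ c ∈ Finset.range (part l i), (hookLength l (i, c) : ℚ) := by
    rw [Nat.cast_prod]
    refine Finset.prod_congr rfl fun c hc => ?_
    rw [Finset.mem_range] at hc
    have := (hrel i c).mp hc
    rw [← Int.cast_natCast]
    congr 1
    simp only [hookLength]
    omega
  have h3 : ((∏ j ∈ Finset.Ioo i k, (part l i + j - part l j - i) : ℕ) : ℚ) =
      ∏ j ∈ Finset.Ioo i k, ((part l i : ℚ) - (part l j : ℚ) + (j : ℚ) - (i : ℚ)) := by
    rw [Nat.cast_prod]
    refine Finset.prod_congr rfl fun j hj => ?_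
    rw [Finset.mem_Ioo] at hj
    have := part_antitone l hj.1.le
    have h4 : ((part l i + j - part l j - i : ℕ) : ℤ) =
        (part l i : ℤ) - (part l j : ℤ) + (j : ℤ) - (i : ℤ) := by omega
    exact_mod_cast congrArg (Int.cast : ℤ → ℚ) h4
  have h5 : ∏ j ∈ Finset.Ioo i k, ((j : ℚ) - (i : ℚ)) = (k - 1 - i).factorial := by
    rw [← Finset.prod_range_add_one_eq_factorial, Nat.cast_prod]
    refine Finset.prod_bij' (fun j _ => j - i - 1) (fun m _ => m + i + 1) ?_ ?_ ?_ ?_ ?_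
    · intro j hj; rw [Finset.mem_Ioo] at hj; rw [Finset.mem_range]; omega
    · intro m hm; rw [Finset.mem_range] at hm; rw [Finset.mem_Ioo]; omega
    · intro j hj; rw [Finset.mem_Ioo] at hj; omega
    · intro m hm; omega
    · intro j hj
      rw [Finset.mem_Ioo] at hj
      rw [Nat.sub_add_cancel (by omega), Nat.cast_sub hj.1.le]
  have h6 : ∀ m : ℕ, ((k - 1 - i).factorial : ℚ) * ∏ c ∈ Finset.range m, ((k : ℚ) + content (i, c))
      = ((m + (k - 1 - i)).factorial : ℚ) := by
    intro m
    induction m with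
    | zero => simp
    | succ m ih =>
      rw [Finset.prod_range_succ, ← mul_assoc, ih, show m + 1 + (k - 1 - i) = m + (k - 1 - i) + 1
        by omega, Nat.factorial_succ, Nat.cast_mul, mul_comm]
      congr 1
      have h7 : ((m + (k - 1 - i) + 1 : ℕ) : ℤ) = (k : ℤ) + content (i, m) := by
        simp only [content]
        omega
      exact_mod_cast (congrArg (Int.cast : ℤ → ℚ) h7).symm
  have h8 := congrArg (Nat.cast : ℕ → ℚ) h1
  rw [Nat.cast_mul, h2, h3, ← h6 (part l i)] at h8
  have h9 : ∏ c ∈ Finset.range (part l i), (hookLength l (i, c) : ℚ) ≠ 0 := by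
    rw [← h2, Nat.cast_ne_zero]
    intro h
    rw [h, zero_mul] at h1
    exact Nat.factorial_ne_zero _ h1.symm
  rw [Finset.prod_div_distrib, Finset.prod_div_distrib, h5, div_eq_div_iff h9
    (Nat.cast_ne_zero.mpr (Nat.factorial_ne_zero _))]
  linarith

theorem schurAtOne_eq_prod_cells {n : ℕ} (k : ℕ) (l : n.Partition) :
    (schurAtOne k l : ℚ) =
      ∏ u ∈ (diagram l).cells, ((k : ℚ) + content u) / (hookLength l u : ℚ) := by
  by_cases hl : length l ≤ k
  · rw [schurAtOne_eq hl, schurValue_eq_prod, ← Finset.prod_fiberwise_of_maps_to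
      (t := Finset.range k) (g := Prod.fst), ← Fin.prod_univ_eq_prod_range
      (fun i => ∏ u ∈ (diagram l).cells with u.1 = i,
        ((k : ℚ) + content u) / (hookLength l u : ℚ))]
    · refine Finset.prod_congr rfl fun i _ => ?_
      have h1 : ((diagram l).cells.filter fun u => u.1 = (i : ℕ)) =
          {(i : ℕ)} ×ˢ Finset.range (part l i) := by
        rw [part_eq_rowLen]
        exact YoungDiagram.row_eq_prod
      rw [h1, Finset.prod_product, Finset.prod_singleton, prod_row_eq l hl i.2,
        ← Fin.map_valEmbedding_Ioi, Finset.prod_map]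
      rfl
    · intro u hu
      rw [YoungDiagram.mem_cells, mem_diagram] at hu
      rw [Finset.mem_range]
      by_contra hcon
      have := part_antitone l (not_lt.mp hcon)
      rw [(length_le_iff l k).mp hl] at this
      omega
  · rw [schurAtOne_eq_zero hl, Int.cast_zero, eq_comm, Finset.prod_eq_zero_iff]
    -- The first box of row `k` has content `-k`, so its numerator vanishes.
    refine ⟨(k, 0), ?_, ?_⟩
    · rw [YoungDiagram.mem_cells, mem_diagram]
      rw [length_le_iff] at hl
      exact Nat.pos_of_ne_zero hl
    · simp [content]

/-! ### Words fixed by a permutation -/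

/-- Orbits are the supports of the nontrivial cycles together with the fixed points; the latter are
the parts equal to one. -/
theorem card_quotient_sameCycle {n : ℕ} (g : Equiv.Perm (Fin n)) :
    Nat.card (Quotient (Equiv.Perm.SameCycle.setoid g)) = Multiset.card g.partition.parts := by
  classical
  have hne : ∀ c : g.cycleFactorsFinset, ∃ x, x ∈ c.1.support := fun c => by
    have h := (Equiv.Perm.mem_cycleFactorsFinset_iff.mp c.2).1
    obtain ⟨x, hx, _⟩ := h
    exact ⟨x, Equiv.Perm.mem_support.mpr hx⟩
  choose r hr using hne
  have hrg : ∀ c, g (r c) ≠ r c := fun c =>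
    Equiv.Perm.mem_support.mp (Equiv.Perm.mem_cycleFactorsFinset_support_le c.2 (hr c))
  let f : g.cycleFactorsFinset ⊕ {x // g x = x} → Quotient (Equiv.Perm.SameCycle.setoid g) :=
    Sum.elim (fun c => Quotient.mk _ (r c)) (fun x => Quotient.mk _ x.1)
  have hfix : ∀ {x y}, g x = x → g.SameCycle x y → x = y := by
    rintro x y hx ⟨m, hm⟩
    rw [← hm]
    exact (Equiv.Perm.zpow_apply_eq_self_of_apply_eq_self hx m).symm
  have hf : Function.Bijective f := by
    constructor
    · rintro (c | x) (c' | x') h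
      · have h1 : g.SameCycle (r c) (r c') := Quotient.exact h
        have h2 := Equiv.Perm.cycle_is_cycleOf (hr c) c.2
        have h3 := Equiv.Perm.cycle_is_cycleOf (hr c') c'.2
        rw [h1.cycleOf_eq, ← h3] at h2
        rw [Subtype.ext h2]
      · have h1 : g.SameCycle (r c) x'.1 := Quotient.exact h
        have h2 := hfix x'.2 h1.symm
        exact absurd (h2 ▸ x'.2) (hrg c)
      · have h1 : g.SameCycle x.1 (r c') := Quotient.exact h
        have h2 := hfix x.2 h1
        exact absurd (h2 ▸ x.2) (hrg c')
      · have h1 : g.SameCycle x.1 x'.1 := Quotient.exact h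
        rw [Subtype.ext (hfix x.2 h1)]
    · intro y
      induction y using Quotient.inductionOn with
      | h x =>
        by_cases hx : g x = x
        · exact ⟨Sum.inr ⟨x, hx⟩, rfl⟩
        · let c : g.cycleFactorsFinset := ⟨g.cycleOf x,
            Equiv.Perm.cycleOf_mem_cycleFactorsFinset_iff.mpr (Equiv.Perm.mem_support.mpr hx)⟩
          refine ⟨Sum.inl c, Quotient.sound ?_⟩
          have h1 := hr c
          exact (Equiv.Perm.mem_support_cycleOf_iff.mp h1).1.symm
  rw [← Nat.card_congr (Equiv.ofBijective f hf), Nat.card_sum, Nat.card_eq_fintype_card,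
    Nat.card_eq_fintype_card, Fintype.card_coe, Equiv.Perm.parts_partition, Multiset.card_add,
    Multiset.card_replicate, Equiv.Perm.cycleType_def, Multiset.card_map, Fintype.card_subtype]
  congr 1
  rw [← Finset.card_compl]
  congr 1
  ext x
  simp

/-- A fixed word is one that is constant on the cycles of `g`, with a free letter for each cycle. -/
theorem fixedWords_eq_pow {n : ℕ} (k : ℕ) (g : Equiv.Perm (Fin n)) :
    fixedWords k g = k ^ Multiset.card g.partition.parts := by
  classical
  have hinv : ∀ w : Fin n → Fin k, wordAction n k g w = w → ∀ i j, g.SameCycle i j → w i = w j := by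
    intro w hw i j hij
    have h1 : ∀ i, w (g i) = w i := fun i => by
      conv_lhs => rw [← hw]
      rw [wordAction_apply]
      simp
    obtain ⟨m, rfl⟩ := hij.exists_nat_pow_eq
    induction m with
    | zero => rfl
    | succ m ih =>
      rw [pow_succ', Equiv.Perm.mul_apply, h1]
      exact ih ⟨m, by simp⟩
  let e : {w : Fin n → Fin k // wordAction n k g w = w} ≃
      (Quotient (Equiv.Perm.SameCycle.setoid g) → Fin k) :=
    { toFun := fun w => Quotient.lift w.1 (hinv w.1 w.2)
      invFun := fun u => ⟨fun i => u (Quotient.mk _ i), funext fun i => by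
        rw [wordAction_apply]
        refine congrArg u (Quotient.sound ?_)
        exact ⟨1, by simp⟩⟩
      left_inv := fun w => rfl
      right_inv := fun u => by
        funext y
        induction y using Quotient.inductionOn with
        | h x => rfl }
  rw [fixedWords, ← Fintype.card_subtype, ← Nat.card_eq_fintype_card, Nat.card_congr e,
    Nat.card_fun, Nat.card_eq_fintype_card (α := Fin k), Fintype.card_fin, card_quotient_sameCycle]

/-! ### The divisor function on squarefree polynomials -/

/-- The prime `p` divides exactly one entry of a factorization of `p * g`; recording its position
and dividing it out is a bijection. -/
theorem divisorFunction_mul {F : Type*} [Field F] (k : ℕ) {p g : F[X]} (hp : p.Monic)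
    (hirr : Irreducible p) (hpg : ¬ p ∣ g) :
    divisorFunction k (p * g) = k * divisorFunction k g := by
  classical
  let f : Fin k × {a : Fin k → F[X] // (∀ i, (a i).Monic) ∧ ∏ i, a i = g} →
      {a : Fin k → F[X] // (∀ i, (a i).Monic) ∧ ∏ i, a i = p * g} := fun z =>
    ⟨Function.update z.2.1 z.1 (p * z.2.1 z.1), by
      refine ⟨fun i => ?_, ?_⟩
      · by_cases hi : i = z.1
        · subst hi
          rw [Function.update_self]
          exact hp.mul (z.2.2.1 _)
        · rw [Function.update_of_ne hi]
          exact z.2.2.1 i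
      · rw [Finset.prod_update_of_mem (Finset.mem_univ _), mul_assoc,
          ← Finset.prod_eq_mul_prod_sdiff_singleton_of_mem (Finset.mem_univ _), z.2.2.2]⟩
  have hndvd : ∀ a : Fin k → F[X], ∏ i, a i = g → ∀ i, ¬ p ∣ a i := fun a ha i h =>
    hpg (ha ▸ h.trans (Finset.dvd_prod_of_mem a (Finset.mem_univ i)))
  have hf : Function.Bijective f := by
    constructor
    · rintro ⟨i, ⟨a, ha⟩⟩ ⟨j, ⟨b, hb⟩⟩ h
      have h1 : Function.update a i (p * a i) = Function.update b j (p * b j) :=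
        congrArg Subtype.val h
      have hij : i = j := by
        by_contra hne
        have h2 := congrFun h1 i
        rw [Function.update_self, Function.update_of_ne hne] at h2
        exact hndvd b hb.2 i ⟨_, h2.symm⟩
      subst hij
      have hab : a = b := by
        funext m
        have h2 := congrFun h1 m
        by_cases hm : m = i
        · subst hm
          rw [Function.update_self, Function.update_self] at h2
          exact mul_left_cancel₀ hp.ne_zero h2
        · rwa [Function.update_of_ne hm, Function.update_of_ne hm] at h2
      subst hab
      rfl
    · rintro ⟨a, ha1, ha2⟩
      obtain ⟨i, _, c, hc⟩ := (hirr.prime.dvd_finsetProd_iff a).mp (ha2 ▸ dvd_mul_right p g)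
      refine ⟨⟨i, ⟨Function.update a i c, ?_, ?_⟩⟩, Subtype.ext ?_⟩
      · intro j
        by_cases hj : j = i
        · subst hj
          rw [Function.update_self]
          exact hp.of_mul_monic_left (hc ▸ ha1 j)
        · rw [Function.update_of_ne hj]
          exact ha1 j
      · apply mul_left_cancel₀ hp.ne_zero
        rw [← ha2, Finset.prod_update_of_mem (Finset.mem_univ _), ← mul_assoc, ← hc,
          ← Finset.prod_eq_mul_prod_sdiff_singleton_of_mem (Finset.mem_univ _)]
      · simp only [f, Function.update_self, Function.update_idem]
        rw [← hc, Function.update_eq_self]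
  rw [divisorFunction, ← Nat.card_congr (Equiv.ofBijective f hf), Nat.card_prod, Nat.card_fin]
  rfl

theorem divisorFunction_one {F : Type*} [Field F] (k : ℕ) :
    divisorFunction k (1 : F[X]) = 1 := by
  rw [divisorFunction, Nat.card_eq_one_iff_unique]
  refine ⟨⟨?_⟩, ⟨⟨fun _ => 1, fun _ => monic_one, by simp⟩⟩⟩
  have h : ∀ a : Fin k → F[X], (∀ i, (a i).Monic) → ∏ i, a i = 1 → a = fun _ => 1 := by
    intro a h1 h2
    funext i
    exact (h1 i).eq_one_of_isUnit
      (isUnit_of_dvd_one (h2 ▸ Finset.dvd_prod_of_mem a (Finset.mem_univ i)))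
  rintro ⟨a, ha⟩ ⟨b, hb⟩
  exact Subtype.ext ((h a ha.1 ha.2).trans (h b hb.1 hb.2).symm)

theorem divisorFunction_prod {F : Type*} [Field F] (k : ℕ) (s : Multiset F[X])
    (hs : ∀ p ∈ s, p.Monic ∧ Irreducible p) (hnd : s.Nodup) :
    divisorFunction k s.prod = k ^ Multiset.card s := by
  induction s using Multiset.induction_on with
  | empty => simp [divisorFunction_one]
  | cons p s ih =>
    rw [Multiset.nodup_cons] at hnd
    obtain ⟨hp, hirr⟩ := hs p (Multiset.mem_cons_self p s)
    have hs' := fun q hq => hs q (Multiset.mem_cons_of_mem hq)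
    rw [Multiset.prod_cons, divisorFunction_mul k hp hirr, ih hs' hnd.2, Multiset.card_cons, pow_succ']
    intro h
    obtain ⟨q, hq, hpq⟩ := hirr.prime.exists_mem_multiset_dvd h
    have h1 := hirr.associated_of_dvd (hs' q hq).2 hpq
    rw [eq_of_monic_of_associated hp (hs' q hq).1 h1] at hnd
    exact hnd.1 hq

theorem divisorFunction_of_squarefree {F : Type*} [Field F] (k : ℕ) {f : F[X]} (hf : f.Monic)
    (hsq : Squarefree f) :
    divisorFunction k f = k ^ Multiset.card (UniqueFactorizationMonoid.factors f) := by
  classical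
  have h0 : f ≠ 0 := hf.ne_zero
  have hmon : ∀ p ∈ UniqueFactorizationMonoid.normalizedFactors f, p.Monic ∧ Irreducible p := by
    intro p hp
    have hirr := UniqueFactorizationMonoid.irreducible_of_normalized_factor p hp
    refine ⟨?_, hirr⟩
    rw [← UniqueFactorizationMonoid.normalize_normalized_factor p hp]
    exact monic_normalize hirr.ne_zero
  have hnd := (UniqueFactorizationMonoid.squarefree_iff_nodup_normalizedFactors h0).mp hsq
  have hprod : (UniqueFactorizationMonoid.normalizedFactors f).prod = f :=
    eq_of_monic_of_associated
      (by simpa using monic_multiset_prod_of_monic _ id fun p hp => (hmon p hp).1) hf (by simpa using UniqueFactorizationMonoid.prod_normalizedFactors h0)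
  have hcard : Multiset.card (UniqueFactorizationMonoid.normalizedFactors f) =
      Multiset.card (UniqueFactorizationMonoid.factors f) := by
    rw [UniqueFactorizationMonoid.normalizedFactors, Multiset.card_map]
  conv_lhs => rw [← hprod]
  rw [divisorFunction_prod k _ hmon hnd, hcard]

theorem pow_card_parts_eq_sum {n : ℕ} (k : ℕ) (t : n.Partition) :
    (k : ℂ) ^ Multiset.card t.parts =
      ∑ l : n.Partition with length l ≤ k, (schurAtOne k l : ℂ) * typeCharacter l t := by
  have h := fixedWords_eq_sum k (exists_perm_of_type t).choose
  rw [fixedWords_eq_pow, (exists_perm_of_type t).choose_spec, Nat.cast_pow] at h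
  rw [h, Finset.sum_filter_of_ne]
  · rfl
  · intro l _ hne
    by_contra hl
    rw [schurAtOne_eq_zero hl] at hne
    simp at hne

end FactorizationExpansion

open FactorizationExpansion
theorem mainTheorem10 {F : Type*} [Field F] [Finite F] (k : ℕ) (hk : 1 ≤ k) :
    (∃ b : Polynomial F → ℂ,
      (∀ f, b f ≠ 0 → f.Monic ∧ ¬ Squarefree f) ∧
      ∀ (n : ℕ) (f : Polynomial F), f.Monic → f.natDegree = n →
        (divisorFunction k f : ℂ) =
          (∑ l : n.Partition with length l ≤ k, (schurAtOne k l : ℂ) * polyCharacter l f)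
            + b f) ∧
    ∀ (n : ℕ) (l : n.Partition),
      (length l ≤ k →
        (schurAtOne k l : ℚ) =
          ∏ i : Fin k, ∏ j ∈ Finset.Ioi i,
            ((part l i : ℚ) - (part l j : ℚ) + ((j : ℕ) : ℚ) - ((i : ℕ) : ℚ)) /
              (((j : ℕ) : ℚ) - ((i : ℕ) : ℚ))) ∧
      (length l ≤ k → schurAtOne k l = (gtCount k l : ℤ)) ∧
      (schurAtOne k l : ℚ) =
        ∏ u ∈ (diagram l).cells, ((k : ℚ) + content u) / (hookLength l u : ℚ) := by
  classical
  -- All characters vanish off the squarefree polynomials, so `b` must be the full divisor function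
  -- there.
  refine ⟨⟨fun f => if f.Monic ∧ ¬ Squarefree f then (divisorFunction k f : ℂ) else 0, ?_, ?_⟩, ?_⟩
  · intro f hf
    by_contra h
    exact hf (if_neg h)
  · intro n f hf hn
    beta_reduce
    by_cases hsq : Squarefree f
    · rw [if_neg (fun h => h.2 hsq), add_zero, divisorFunction_of_squarefree k hf hsq]
      have h := pow_card_parts_eq_sum k (factorizationType f hsq hn)
      have hp : Multiset.card (factorizationType f hsq hn).parts =
          Multiset.card (UniqueFactorizationMonoid.factors f) := Multiset.card_map _ _
      rw [hp] at h
      rw [Nat.cast_pow, h]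
      refine Finset.sum_congr rfl fun l _ => ?_
      rw [polyCharacter, dif_pos ⟨hsq, hn⟩]
    · rw [if_pos ⟨hf, hsq⟩, Finset.sum_eq_zero, zero_add]
      intro l _
      rw [polyCharacter, dif_neg (fun h => hsq h.1), mul_zero]
  · intro n l
    refine ⟨fun hl => ?_, fun hl => ?_, schurAtOne_eq_prod_cells k l⟩
    · rw [schurAtOne_eq hl]
      exact schurValue_eq_prod k (part l)
    · rw [schurAtOne_eq hl, gtCount_eq]
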